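/- Let $N\ge 1$ and write points of $\mathbb{R}^{N+1}$ as $(\xi,y)$ with $\xi\in\mathbb{R}^N$, $y\in\mathbb{R}$. **Model tooth.** $Y\subset\mathbb{R}^{N+1}$ is a model tooth if it is a domain (open and connected), $Y\subset B(0,R_1)\times(0,L)$ for some $R_1,L>0$, and there is a bounded Lipschitz domain $\omega\subset\mathbb{R}^N$ with $0\in\omega$, $|\omega|=1$, $\partial Y\cap(\mathbb{R}^N\times\{0\})=\bar\omega\times\{0\}$ and $\omega\times(0,\delta_0)\subset Y$ for some $\delta_0>0$. **Nice decomposition.** A nice decomposition of $Y$ consists of heights $0=a_0<a_1<\dots<a_M$ ($M\ge1$) with $Y\subset\mathbb{R}^N\times(0,a_M)$ such that, with $I=\{1,\dots,M\}$: for each $i\in I$ the set $Y\cap(\mathbb{R}^N\times(a_{i-1},a_i))$ has finitely many (at least one) connected components $Y_i^1,\dots,Y_i^{m_i}$; $m_1=1$; for all $i\in I$ and $j\in J_i=\{1,\dots,m_i\}$ and every $y$, the section $\{q\in Y_i^j: q \text{ has height } y\}$ is connected (possibly empty); and the function $p_i^j(y)=|\{\xi:(\xi,y)\in Y_i^j\}|$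 on $(a_{i-1},a_i)$, extended to $a_{i-1},a_i$ by its limits, is in $C([a_{i-1},a_i])\cap C^1((a_{i-1},a_i))$ and is positive on $[a_{i-1},a_i]$. Write $Y_i^j\overset{i}{\sim}Y_{i+1}^{j'}$ if some ball $B\subset Y$ meets both $Y_i^j$ and $Y_{i+1}^{j'}$. **Spaces.** $H^1_{\langle\xi\rangle}(Y)=\{u\in H^1(Y):\nabla_\xi u=0\text{ a.e.}\}$ with the norm of $H^1(Y)$. $H^1((a,b),p)$ is the space of $f\in L^2((a,b),p)$ with weak derivative $f'\in L^2((a,b),p)$ and norm $\|f\|^2=\int_a^b p\,(f^2+(f')^2)$. Since each $p_i^j$ is bounded below by a positive constant, every element of $H^1((a_{i-1},a_i),p_i^j)$ has a unique continuous representative on $[a_{i-1},a_i]$, with which it is identified. $\mathscr H(Y)$ is the space of families $\boldsymbol\varphi=\{\varphi_i^j\}_{i\in I,j\in J_i}$, $\varphi_i^j\in H^1((a_{i-1},a_i),p_i^j)$, with $\varphi_i^j(a_i)=\varphi_{i+1}^{j'}(a_i)$ whenever $Y_i^j\overset{i}{\sim}Y_{i+1}^{j'}$, and norm $\|\boldsymbol\varphi\|^2=\sum_{i\in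 I}\sum_{j\in J_i}\|\varphi_i^j\|^2_{H^1((a_{i-1},a_i),p_i^j)}$. All functions are real-valued. **Claim.** For every model tooth $Y$ with a nice decomposition, there is a linear isometric bijection $T:H^1_{\langle\xi\rangle}(Y)\to\mathscr H(Y)$ such that: 1. if $T\varphi=\{\varphi_i^j\}$, then $\varphi(\xi,y)=\varphi_i^j(y)$ and $\frac{\partial\varphi}{\partial y}(\xi,y)=(\varphi_i^j)'(y)$ for a.e. $(\xi,y)\in Y_i^j$, for all $i\in I$, $j\in J_i$; 2. $\|\varphi\|^2_{H^1(Y)}=\sum_{i,j}\int_{Y_i^j}\big(\varphi^2+(\tfrac{\partial\varphi}{\partial y})^2\big)$ for all $\varphi\in H^1_{\langle\xi\rangle}(Y)$, and $\|\boldsymbol\varphi\|^2_{\mathscr H(Y)}=\sum_{i,j}\int_{a_{i-1}}^{a_i}p_i^j\big((\varphi_i^j)^2+((\varphi_i^j)')^2\big)$ for all $\boldsymbol\varphi\in\mathscr H(Y)$; 3. for $\boldsymbol\varphi\in\mathscr H(Y)$ the prescription $\varphi(\xi,y)=\varphi_i^j(y)$ for $(\xi,y)\in Y_i^j$ and $\varphi(\xi,a_i)=\varphi_i^j(a_i)$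 for $(\xi,a_i)\in Y\cap\overline{Y_i^j}$ ($i\in I$, $j\in J_i$) is consistent and determines exactly one function on $Y$, and this function equals $T^{-1}\boldsymbol\varphi$ a.e. in $Y$. -/

import Mathlib

open MeasureTheory Set Filter Topology
open scoped ENNReal

noncomputable section

namespace ThinGraph

/-- The horizontal space `ℝ^N` (Euclidean norm). -/
abbrev Hor (N : ℕ) : Type := EuclideanSpace ℝ (Fin N)

/-- `ℝ^{N+1}`, a point being written `(ξ, y)` with `ξ ∈ ℝ^N` and `y ∈ ℝ`; `volume` is Lebesgue
measure.  The product metric is not used below, only its topology and its bounded sets. -/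
abbrev Pt (N : ℕ) : Type := Hor N × ℝ

/-- The Euclidean ball of `ℝ^{N+1}` with centre `c` and radius `r`. -/
def eball {N : ℕ} (c : Pt N) (r : ℝ) : Set (Pt N) :=
  {q | ‖q.1 - c.1‖ ^ 2 + (q.2 - c.2) ^ 2 < r ^ 2}

/-! ### The Sobolev space `H¹(S)` for `S ⊆ ℝ^{N+1}` -/

/-- Test functions: smooth, with compact support contained in `S`. -/
structure IsTest {F : Type*} [NormedAddCommGroup F] [NormedSpace ℝ F]
    (S : Set F) (η : F → ℝ) : Prop where
  smooth : ContDiff ℝ (⊤ : ℕ∞) η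
  compact : HasCompactSupport η
  support : tsupport η ⊆ S

theorem IsTest.memLp {F : Type*} [NormedAddCommGroup F] [NormedSpace ℝ F] [MeasurableSpace F]
    [OpensMeasurableSpace F] {S : Set F} {η : F → ℝ}
    (h : IsTest S η) (μ : Measure F) [IsFiniteMeasureOnCompacts μ] : MemLp η 2 μ :=
  h.smooth.continuous.memLp_of_hasCompactSupport h.compact

theorem IsTest.memLp_fderiv {F : Type*} [NormedAddCommGroup F] [NormedSpace ℝ F]
    [MeasurableSpace F] [OpensMeasurableSpace F] {S : Set F} {η : F → ℝ}
    (h : IsTest S η) (v : F) (μ : Measure F) [IsFiniteMeasureOnCompacts μ] :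
    MemLp (fun q => fderiv ℝ η q v) 2 μ :=
  ((h.smooth.continuous_fderiv (by simp)).clm_apply
    continuous_const).memLp_of_hasCompactSupport (h.compact.fderiv_apply ℝ v)

/-- `G = ∇_ξ u` and `g = ∂u/∂y` in the weak sense on `S`. -/
structure HasWeakGrad {N : ℕ} (S : Set (Pt N)) (u : Pt N → ℝ) (G : Pt N → Hor N)
    (g : Pt N → ℝ) : Prop where
  hor : ∀ η : Pt N → ℝ, IsTest S η → ∀ v : Hor N,
    ∫ q in S, u q * fderiv ℝ η q (v, 0) = -∫ q in S, inner ℝ (G q) v * η q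
  ver : ∀ η : Pt N → ℝ, IsTest S η →
    ∫ q in S, u q * fderiv ℝ η q (0, 1) = -∫ q in S, g q * η q

/-- `L²(S) × L²(S; ℝ^N) × L²(S)` with its Hilbert norm. -/
abbrev H1Ambient {N : ℕ} (S : Set (Pt N)) : Type :=
  WithLp 2 (Lp ℝ 2 (volume.restrict S) ×
    WithLp 2 (Lp (Hor N) 2 (volume.restrict S) × Lp ℝ 2 (volume.restrict S)))

/-- `H¹(S)`: an element is a function `u ∈ L²(S)` together with its weak derivatives
`∇_ξ u ∈ L²(S; ℝ^N)` and `∂u/∂y ∈ L²(S)` (which are determined by `u` when `S` is open), so the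
norm is `‖u‖² = ∫_S (u² + |∇_ξ u|² + (∂u/∂y)²)`. -/
def H1 {N : ℕ} (S : Set (Pt N)) : Submodule ℝ (H1Ambient S) where
  carrier := {w | HasWeakGrad S w.fst w.snd.fst w.snd.snd}
  zero_mem' := by
    have h0 : ∀ᵐ q ∂(volume.restrict S), (0 : H1Ambient S).fst q = 0 := Lp.coeFn_zero ℝ 2 _
    have h1 : ∀ᵐ q ∂(volume.restrict S), (0 : H1Ambient S).snd.fst q = 0 :=
      Lp.coeFn_zero (Hor N) 2 _
    have h2 : ∀ᵐ q ∂(volume.restrict S), (0 : H1Ambient S).snd.snd q = 0 := Lp.coeFn_zero ℝ 2 _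
    refine ⟨fun η hη v => ?_, fun η hη => ?_⟩
    · rw [integral_eq_zero_of_ae, integral_eq_zero_of_ae, neg_zero]
      · filter_upwards [h1] with q hq
        rw [hq]; simp
      · filter_upwards [h0] with q hq
        rw [hq]; simp
    · rw [integral_eq_zero_of_ae, integral_eq_zero_of_ae, neg_zero]
      · filter_upwards [h2] with q hq
        rw [hq]; simp
      · filter_upwards [h0] with q hq
        rw [hq]; simp
  add_mem' := by
    intro w z hw hz
    have h0 : ∀ᵐ q ∂(volume.restrict S), (w + z).fst q = w.fst q + z.fst q :=
      Lp.coeFn_add w.fst z.fst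
    have h1 : ∀ᵐ q ∂(volume.restrict S), (w + z).snd.fst q = w.snd.fst q + z.snd.fst q :=
      Lp.coeFn_add w.snd.fst z.snd.fst
    have h2 : ∀ᵐ q ∂(volume.restrict S), (w + z).snd.snd q = w.snd.snd q + z.snd.snd q :=
      Lp.coeFn_add w.snd.snd z.snd.snd
    refine ⟨fun η hη v => ?_, fun η hη => ?_⟩
    · have e1 : ∫ q in S, (w + z).fst q * fderiv ℝ η q (v, 0)
          = ∫ q in S, (w.fst q * fderiv ℝ η q (v, 0) + z.fst q * fderiv ℝ η q (v, 0)) := by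
        refine integral_congr_ae ?_
        filter_upwards [h0] with q hq
        rw [hq, add_mul]
      have e2 : ∫ q in S, inner ℝ ((w + z).snd.fst q) v * η q
          = ∫ q in S, (inner ℝ (w.snd.fst q) v * η q + inner ℝ (z.snd.fst q) v * η q) := by
        refine integral_congr_ae ?_
        filter_upwards [h1] with q hq
        rw [hq, inner_add_left, add_mul]
      have i1 : ∀ x : H1Ambient S, Integrable (fun q => x.fst q * fderiv ℝ η q (v, 0))
          (volume.restrict S) := fun x =>
        (Lp.memLp x.fst).integrable_mul (hη.memLp_fderiv (v, 0) _)
      have i2 : ∀ x : H1Ambient S, Integrable (fun q => inner ℝ (x.snd.fst q) v * η q)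
          (volume.restrict S) := fun x =>
        ((Lp.memLp x.snd.fst).inner_const v).integrable_mul (hη.memLp _)
      rw [e1, e2, integral_add (i1 w) (i1 z), integral_add (i2 w) (i2 z), hw.hor η hη v,
        hz.hor η hη v]
      ring
    · have e1 : ∫ q in S, (w + z).fst q * fderiv ℝ η q (0, 1)
          = ∫ q in S, (w.fst q * fderiv ℝ η q (0, 1) + z.fst q * fderiv ℝ η q (0, 1)) := by
        refine integral_congr_ae ?_
        filter_upwards [h0] with q hq
        rw [hq, add_mul]
      have e2 : ∫ q in S, (w + z).snd.snd q * η q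
          = ∫ q in S, (w.snd.snd q * η q + z.snd.snd q * η q) := by
        refine integral_congr_ae ?_
        filter_upwards [h2] with q hq
        rw [hq, add_mul]
      have i1 : ∀ x : H1Ambient S, Integrable (fun q => x.fst q * fderiv ℝ η q (0, 1))
          (volume.restrict S) := fun x =>
        (Lp.memLp x.fst).integrable_mul (hη.memLp_fderiv (0, 1) _)
      have i2 : ∀ x : H1Ambient S, Integrable (fun q => x.snd.snd q * η q)
          (volume.restrict S) := fun x =>
        (Lp.memLp x.snd.snd).integrable_mul (hη.memLp _)
      rw [e1, e2, integral_add (i1 w) (i1 z), integral_add (i2 w) (i2 z), hw.ver η hη,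
        hz.ver η hη]
      ring
  smul_mem' := by
    intro c w hw
    have h0 : ∀ᵐ q ∂(volume.restrict S), (c • w).fst q = c * w.fst q :=
      Lp.coeFn_smul c w.fst
    have h1 : ∀ᵐ q ∂(volume.restrict S), (c • w).snd.fst q = c • w.snd.fst q :=
      Lp.coeFn_smul c w.snd.fst
    have h2 : ∀ᵐ q ∂(volume.restrict S), (c • w).snd.snd q = c * w.snd.snd q :=
      Lp.coeFn_smul c w.snd.snd
    refine ⟨fun η hη v => ?_, fun η hη => ?_⟩
    · have e1 : ∫ q in S, (c • w).fst q * fderiv ℝ η q (v, 0)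
          = ∫ q in S, c * (w.fst q * fderiv ℝ η q (v, 0)) := by
        refine integral_congr_ae ?_
        filter_upwards [h0] with q hq
        rw [hq, mul_assoc]
      have e2 : ∫ q in S, inner ℝ ((c • w).snd.fst q) v * η q
          = ∫ q in S, c * (inner ℝ (w.snd.fst q) v * η q) := by
        refine integral_congr_ae ?_
        filter_upwards [h1] with q hq
        rw [hq, real_inner_smul_left, mul_assoc]
      rw [e1, e2, integral_const_mul, integral_const_mul, hw.hor η hη v]
      ring
    · have e1 : ∫ q in S, (c • w).fst q * fderiv ℝ η q (0, 1)
          = ∫ q in S, c * (w.fst q * fderiv ℝ η q (0, 1)) := by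
        refine integral_congr_ae ?_
        filter_upwards [h0] with q hq
        rw [hq, mul_assoc]
      have e2 : ∫ q in S, (c • w).snd.snd q * η q
          = ∫ q in S, c * (w.snd.snd q * η q) := by
        refine integral_congr_ae ?_
        filter_upwards [h2] with q hq
        rw [hq, mul_assoc]
      rw [e1, e2, integral_const_mul, integral_const_mul, hw.ver η hη]
      ring

/-- `H¹_⟨ξ⟩(S)`: the functions of `H¹(S)` with `∇_ξ u = 0` a.e. in `S`, with the norm of `H¹(S)`. -/
def H1Xi {N : ℕ} (S : Set (Pt N)) : Submodule ℝ (H1 S) where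
  carrier := {u | (u : H1Ambient S).snd.fst = 0}
  zero_mem' := rfl
  add_mem' := by
    intro u v hu hv
    have : ((u + v : H1 S) : H1Ambient S).snd.fst
        = (u : H1Ambient S).snd.fst + (v : H1Ambient S).snd.fst := rfl
    exact this.trans (by rw [show (u : H1Ambient S).snd.fst = 0 from hu,
      show (v : H1Ambient S).snd.fst = 0 from hv, add_zero])
  smul_mem' := by
    intro c u hu
    have : ((c • u : H1 S) : H1Ambient S).snd.fst = c • (u : H1Ambient S).snd.fst := rfl
    exact this.trans (by rw [show (u : H1Ambient S).snd.fst = 0 from hu, smul_zero])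

/-- The function underlying an element of `H¹_⟨ξ⟩(S)` (a representative). -/
def fn {N : ℕ} {S : Set (Pt N)} (u : H1Xi S) : Pt N → ℝ :=
  ((u : H1 S) : H1Ambient S).fst

/-- The weak derivative `∂u/∂y` of `u ∈ H¹_⟨ξ⟩(S)` (a representative). -/
def dy {N : ℕ} {S : Set (Pt N)} (u : H1Xi S) : Pt N → ℝ :=
  ((u : H1 S) : H1Ambient S).snd.snd

/-! ### The weighted Sobolev space `H¹((a,b), p)` -/

/-- `g` is the weak derivative of `f` on the interval `(a, b)`. -/
def HasWeakDeriv (a b : ℝ) (f g : ℝ → ℝ) : Prop :=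
  ∀ η : ℝ → ℝ, IsTest (Ioo a b) η →
    ∫ y in Ioo a b, f y * deriv η y = -∫ y in Ioo a b, g y * η y

/-- The measure `p(y) dy` on `(a, b)`. -/
def wMeasure (a b : ℝ) (p : ℝ → ℝ) : Measure ℝ :=
  (volume.restrict (Ioo a b)).withDensity fun y => ENNReal.ofReal (p y)

/-- An admissible weight on `[a, b]`: continuous and positive. -/
structure IsWeight (a b : ℝ) (p : ℝ → ℝ) : Prop where
  cont : ContinuousOn p (Icc a b)
  pos : ∀ y ∈ Icc a b, 0 < p y

theorem IsWeight.restrict_le {a b : ℝ} {p : ℝ → ℝ} (hp : IsWeight a b p) :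
    ∃ c : ℝ≥0∞, c ≠ ⊤ ∧ volume.restrict (Ioo a b) ≤ c • wMeasure a b p := by
  rcases (Icc a b).eq_empty_or_nonempty with he | hne
  · refine ⟨0, by simp, ?_⟩
    have : Ioo a b = ∅ := subset_empty_iff.1 (he ▸ Ioo_subset_Icc_self)
    simp [this]
  · obtain ⟨x, hx, hmin⟩ := isCompact_Icc.exists_isMinOn hne hp.cont
    have hx0 := hp.pos x hx
    have hne0 : ENNReal.ofReal (p x) ≠ 0 := by simpa using hx0
    refine ⟨(ENNReal.ofReal (p x))⁻¹, by simpa using hx0, ?_⟩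
    have h1 : ENNReal.ofReal (p x) • volume.restrict (Ioo a b) ≤ wMeasure a b p := by
      rw [← withDensity_const]
      refine withDensity_mono ?_
      filter_upwards [ae_restrict_mem measurableSet_Ioo] with y hy
      exact ENNReal.ofReal_le_ofReal (hmin (Ioo_subset_Icc_self hy))
    intro s
    have h2 := h1 s
    simp only [Measure.smul_apply, smul_eq_mul] at h2 ⊢
    calc volume.restrict (Ioo a b) s
        = (ENNReal.ofReal (p x))⁻¹ * (ENNReal.ofReal (p x) * volume.restrict (Ioo a b) s) := by
          rw [← mul_assoc, ENNReal.inv_mul_cancel hne0 ENNReal.ofReal_ne_top, one_mul]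
      _ ≤ _ := by gcongr

theorem IsWeight.memLp {a b : ℝ} {p : ℝ → ℝ} (hp : IsWeight a b p)
    (f : Lp ℝ 2 (wMeasure a b p)) : MemLp f 2 (volume.restrict (Ioo a b)) := by
  obtain ⟨c, hc, hle⟩ := hp.restrict_le
  exact (Lp.memLp f).of_measure_le_smul hc hle

theorem IsWeight.ae {a b : ℝ} {p : ℝ → ℝ} (hp : IsWeight a b p) {P : ℝ → Prop}
    (h : ∀ᵐ y ∂(wMeasure a b p), P y) : ∀ᵐ y ∂(volume.restrict (Ioo a b)), P y := by
  obtain ⟨c, _, hle⟩ := hp.restrict_le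
  exact (Measure.absolutelyContinuous_of_le_smul hle).ae_le h

theorem IsTest.memLp_deriv {S : Set ℝ} {η : ℝ → ℝ} (h : IsTest S η) (μ : Measure ℝ)
    [IsFiniteMeasureOnCompacts μ] : MemLp (deriv η) 2 μ :=
  (h.smooth.continuous_deriv (by simp)).memLp_of_hasCompactSupport h.compact.deriv

/-- `L²((a,b),p) × L²((a,b),p)` with its Hilbert norm. -/
abbrev WAmbient (a b : ℝ) (p : ℝ → ℝ) : Type :=
  WithLp 2 (Lp ℝ 2 (wMeasure a b p) × Lp ℝ 2 (wMeasure a b p))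

/-- `H¹((a,b),p)`: an element is a function `f ∈ L²((a,b),p)` together with its weak derivative
`f' ∈ L²((a,b),p)`, so the norm is `‖f‖² = ∫_a^b p (f² + f'²)`. -/
def WH1 (a b : ℝ) (p : ℝ → ℝ) (hp : IsWeight a b p) : Submodule ℝ (WAmbient a b p) where
  carrier := {w | HasWeakDeriv a b w.fst w.snd}
  zero_mem' := by
    have h0 : ∀ᵐ y ∂(volume.restrict (Ioo a b)), (0 : WAmbient a b p).fst y = 0 :=
      hp.ae (Lp.coeFn_zero ℝ 2 (wMeasure a b p))
    have h1 : ∀ᵐ y ∂(volume.restrict (Ioo a b)), (0 : WAmbient a b p).snd y = 0 :=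
      hp.ae (Lp.coeFn_zero ℝ 2 (wMeasure a b p))
    intro η hη
    rw [integral_eq_zero_of_ae, integral_eq_zero_of_ae, neg_zero]
    · filter_upwards [h1] with q hq
      rw [hq]; simp
    · filter_upwards [h0] with q hq
      rw [hq]; simp
  add_mem' := by
    intro w z hw hz η hη
    have h0 : ∀ᵐ y ∂(volume.restrict (Ioo a b)), (w + z).fst y = w.fst y + z.fst y :=
      hp.ae (Lp.coeFn_add w.fst z.fst)
    have h1 : ∀ᵐ y ∂(volume.restrict (Ioo a b)), (w + z).snd y = w.snd y + z.snd y :=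
      hp.ae (Lp.coeFn_add w.snd z.snd)
    have e1 : ∫ y in Ioo a b, (w + z).fst y * deriv η y
        = ∫ y in Ioo a b, (w.fst y * deriv η y + z.fst y * deriv η y) := by
      refine integral_congr_ae ?_
      filter_upwards [h0] with q hq
      rw [hq, add_mul]
    have e2 : ∫ y in Ioo a b, (w + z).snd y * η y
        = ∫ y in Ioo a b, (w.snd y * η y + z.snd y * η y) := by
      refine integral_congr_ae ?_
      filter_upwards [h1] with q hq
      rw [hq, add_mul]
    have i1 : ∀ x : WAmbient a b p, Integrable (fun y => x.fst y * deriv η y)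
        (volume.restrict (Ioo a b)) := fun x =>
      (hp.memLp x.fst).integrable_mul (hη.memLp_deriv _)
    have i2 : ∀ x : WAmbient a b p, Integrable (fun y => x.snd y * η y)
        (volume.restrict (Ioo a b)) := fun x =>
      (hp.memLp x.snd).integrable_mul (hη.memLp _)
    rw [e1, e2, integral_add (i1 w) (i1 z), integral_add (i2 w) (i2 z), hw η hη, hz η hη]
    ring
  smul_mem' := by
    intro c w hw η hη
    have h0 : ∀ᵐ y ∂(volume.restrict (Ioo a b)), (c • w).fst y = c * w.fst y :=
      hp.ae (Lp.coeFn_smul c w.fst)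
    have h1 : ∀ᵐ y ∂(volume.restrict (Ioo a b)), (c • w).snd y = c * w.snd y :=
      hp.ae (Lp.coeFn_smul c w.snd)
    have e1 : ∫ y in Ioo a b, (c • w).fst y * deriv η y
        = ∫ y in Ioo a b, c * (w.fst y * deriv η y) := by
      refine integral_congr_ae ?_
      filter_upwards [h0] with q hq
      rw [hq, mul_assoc]
    have e2 : ∫ y in Ioo a b, (c • w).snd y * η y
        = ∫ y in Ioo a b, c * (w.snd y * η y) := by
      refine integral_congr_ae ?_
      filter_upwards [h1] with q hq
      rw [hq, mul_assoc]
    rw [e1, e2, integral_const_mul, integral_const_mul, hw η hη]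
    ring

/-- The function underlying an element of `H¹((a,b),p)` (a representative). -/
def wfn {a b : ℝ} {p : ℝ → ℝ} {hp : IsWeight a b p} (f : WH1 a b p hp) : ℝ → ℝ :=
  (f : WAmbient a b p).fst

/-- The weak derivative of an element of `H¹((a,b),p)` (a representative). -/
def wder {a b : ℝ} {p : ℝ → ℝ} {hp : IsWeight a b p} (f : WH1 a b p hp) : ℝ → ℝ :=
  (f : WAmbient a b p).snd

/-- `F`, on `[a, b]`, is the continuous representative of `f ∈ H¹((a,b),p)`. -/
def IsContRepOf {a b : ℝ} {p : ℝ → ℝ} {hp : IsWeight a b p} (f : WH1 a b p hp)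
    (F : ℝ → ℝ) : Prop :=
  ContinuousOn F (Icc a b) ∧ ∀ᵐ y ∂(volume.restrict (Ioo a b)), F y = wfn f y

/-! ### Model teeth and nice decompositions -/

/-- Bounded Lipschitz domains of `ℝ^N`: bounded, open, connected, and near each boundary point, for
a suitable unit vector `e`, the set is the strict epigraph in the direction `e` of a Lipschitz
function of the component orthogonal to `e`. -/
structure IsLipschitzDomain {N : ℕ} (ω : Set (Hor N)) : Prop where
  isOpen : IsOpen ω
  isConnected : IsConnected ω
  isBounded : Bornology.IsBounded ω
  boundary : ∀ x ∈ frontier ω, ∃ (e : Hor N) (r : ℝ) (K : NNReal) (γ : Hor N → ℝ),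
    ‖e‖ = 1 ∧ 0 < r ∧ LipschitzWith K γ ∧
      ω ∩ Metric.ball x r = {z | γ (z - inner ℝ z e • e) < inner ℝ z e} ∩ Metric.ball x r

/-- Model teeth. -/
structure IsModelTooth {N : ℕ} (Y : Set (Pt N)) : Prop where
  isOpen : IsOpen Y
  isConnected : IsConnected Y
  bounded : ∃ R L : ℝ, 0 < R ∧ 0 < L ∧ ∀ q ∈ Y, ‖q.1‖ < R ∧ 0 < q.2 ∧ q.2 < L
  base : ∃ ω : Set (Hor N), IsLipschitzDomain ω ∧ (0 : Hor N) ∈ ω ∧ volume ω = 1 ∧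
    frontier Y ∩ {q | q.2 = 0} = closure ω ×ˢ {(0 : ℝ)} ∧
    ∃ δ : ℝ, 0 < δ ∧ ω ×ˢ Ioo 0 δ ⊆ Y

/-- The part of `Y` at heights in `(a, b)`. -/
def slab {N : ℕ} (Y : Set (Pt N)) (a b : ℝ) : Set (Pt N) := Y ∩ {q | q.2 ∈ Ioo a b}

/-- `S` has connected horizontal sections (possibly empty). -/
def HasConnectedSections {N : ℕ} (S : Set (Pt N)) : Prop :=
  ∀ y : ℝ, IsPreconnected {q | q ∈ S ∧ q.2 = y}

/-- `p_S(y) = |{ξ : (ξ, y) ∈ S}|`. -/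
def thickness {N : ℕ} (S : Set (Pt N)) (y : ℝ) : ℝ :=
  (volume : Measure (Hor N)).real {ξ | (ξ, y) ∈ S}

open Classical in
/-- `p_S` on `(a, b)`, extended to the end points by its limits from inside `(a, b)`. -/
def closedThickness {N : ℕ} (S : Set (Pt N)) (a b : ℝ) (y : ℝ) : ℝ :=
  if y ∈ Ioo a b then thickness S y else limUnder (𝓝[Ioo a b] y) (thickness S)

/-- A nice decomposition of `Y`: heights `0 = a₀ < a₁ < ⋯ < a_M`, with `Y` lying below height `a_M`,
and for each `i` an enumeration without repetition `comp i 0, …, comp i (m i - 1)` of the connected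
components of the slab `Y ∩ (ℝ^N × (a_i, a_{i+1}))` (slabs and components are numbered from `0`). -/
structure NiceDecomposition {N : ℕ} (Y : Set (Pt N)) where
  M : ℕ
  M_pos : 0 < M
  a : Fin (M + 1) → ℝ
  a_zero : a 0 = 0
  a_strictMono : StrictMono a
  height_lt : ∀ q ∈ Y, q.2 < a (Fin.last M)
  m : Fin M → ℕ
  m_pos : ∀ i, 0 < m i
  comp : (i : Fin M) → Fin (m i) → Set (Pt N)
  comp_injective : ∀ i, Function.Injective (comp i)
  range_comp : ∀ i, Set.range (comp i) =
    {C | ∃ q ∈ slab Y (a i.castSucc) (a i.succ),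
      C = connectedComponentIn (slab Y (a i.castSucc) (a i.succ)) q}
  m_first : m ⟨0, M_pos⟩ = 1
  connectedSections : ∀ i j, HasConnectedSections (comp i j)
  thickness_continuousOn : ∀ i j,
    ContinuousOn (closedThickness (comp i j) (a i.castSucc) (a i.succ))
      (Icc (a i.castSucc) (a i.succ))
  thickness_contDiffOn : ∀ i j,
    ContDiffOn ℝ 1 (closedThickness (comp i j) (a i.castSucc) (a i.succ))
      (Ioo (a i.castSucc) (a i.succ))
  thickness_pos : ∀ i j, ∀ y ∈ Icc (a i.castSucc) (a i.succ),
    0 < closedThickness (comp i j) (a i.castSucc) (a i.succ) y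

namespace NiceDecomposition

variable {N : ℕ} {Y : Set (Pt N)} (D : NiceDecomposition Y)

/-- The index set of the pieces: pairs `(i, j)`. -/
abbrev Idx : Type := Σ i : Fin D.M, Fin (D.m i)

/-- The piece of index `(i, j)`. -/
def piece (s : D.Idx) : Set (Pt N) := D.comp s.1 s.2

/-- The lower end of the interval of heights of a piece. -/
def lo (s : D.Idx) : ℝ := D.a s.1.castSucc

/-- The upper end of the interval of heights of a piece. -/
def hi (s : D.Idx) : ℝ := D.a s.1.succ

/-- The weight of a piece. -/
def p (s : D.Idx) : ℝ → ℝ := closedThickness (D.piece s) (D.lo s) (D.hi s)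

theorem isWeight (s : D.Idx) : IsWeight (D.lo s) (D.hi s) (D.p s) :=
  ⟨D.thickness_continuousOn s.1 s.2, D.thickness_pos s.1 s.2⟩

/-- The piece `s`, in some slab, joins the piece `t`, in the next slab: some ball contained in `Y`
meets both. -/
def Joins (s t : D.Idx) : Prop :=
  (t.1 : ℕ) = (s.1 : ℕ) + 1 ∧ ∃ (c : Pt N) (r : ℝ), eball c r ⊆ Y ∧
    (eball c r ∩ D.piece s).Nonempty ∧ (eball c r ∩ D.piece t).Nonempty

/-- The weighted space attached to a piece. -/
abbrev EdgeH1 (s : D.Idx) : Type := WH1 (D.lo s) (D.hi s) (D.p s) (D.isWeight s)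

/-- `F` is the family of continuous representatives of `φ`. -/
def IsContRep (φ : PiLp 2 D.EdgeH1) (F : D.Idx → ℝ → ℝ) : Prop :=
  ∀ s, IsContRepOf (φ s) (F s)

/-- The continuity conditions: at the height where a piece joins another one, the values of the
two functions agree. -/
def ContinuityConditions (F : D.Idx → ℝ → ℝ) : Prop :=
  ∀ s t, D.Joins s t → F s (D.hi s) = F t (D.hi s)

/-- The graph space `ℋ(Y)`: families of elements of the weighted spaces whose continuous
representatives satisfy the continuity conditions.  The norm is
`‖φ‖² = ∑ ‖φ_i^j‖²`, the norms on the right being those of the weighted spaces. -/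
def graphSpace : Submodule ℝ (PiLp 2 D.EdgeH1) where
  carrier := {φ | ∃ F, D.IsContRep φ F ∧ D.ContinuityConditions F}
  zero_mem' := by
    refine ⟨fun _ _ => 0, fun s => ⟨continuousOn_const, ?_⟩, fun _ _ _ => rfl⟩
    filter_upwards [(D.isWeight s).ae (Lp.coeFn_zero ℝ 2 _)] with y hy
    exact hy.symm
  add_mem' := by
    rintro φ ψ ⟨F, hF, hF'⟩ ⟨G, hG, hG'⟩
    refine ⟨fun s y => F s y + G s y, fun s => ⟨(hF s).1.add (hG s).1, ?_⟩, fun s t h => ?_⟩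
    · filter_upwards [(D.isWeight s).ae (Lp.coeFn_add
        ((φ s : WAmbient (D.lo s) (D.hi s) (D.p s))).fst
        ((ψ s : WAmbient (D.lo s) (D.hi s) (D.p s))).fst), (hF s).2, (hG s).2] with y hy h1 h2
      rw [h1, h2]
      exact hy.symm
    · simp only [hF' s t h, hG' s t h]
  smul_mem' := by
    rintro c φ ⟨F, hF, hF'⟩
    refine ⟨fun s y => c * F s y, fun s => ⟨continuousOn_const.mul (hF s).1, ?_⟩, fun s t h => ?_⟩
    · filter_upwards [(D.isWeight s).ae (Lp.coeFn_smul c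
        ((φ s : WAmbient (D.lo s) (D.hi s) (D.p s))).fst), (hF s).2] with y hy h1
      rw [h1]
      exact hy.symm
    · simp only [hF' s t h]

/-- The component `φ_i^j` of `φ ∈ ℋ(Y)`. -/
def edge (φ : D.graphSpace) (s : D.Idx) : D.EdgeH1 s := (φ : PiLp 2 D.EdgeH1) s

/-- `w` is, on `Y`, the function induced by the family `F`: `w(ξ, y) = F_i^j(y)` on the piece
`(i, j)`, and `w(ξ, y) = F_i^j(y)` at the points of `Y` in the closure of the piece whose height
`y` is the upper end of the slab. -/
def IsInduced (F : D.Idx → ℝ → ℝ) (w : Pt N → ℝ) : Prop :=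
  (∀ s, ∀ q ∈ D.piece s, w q = F s q.2) ∧
  (∀ s, ∀ q ∈ Y ∩ closure (D.piece s), q.2 = D.hi s → w q = F s (D.hi s))

end NiceDecomposition

end ThinGraph

end

open MeasureTheory Set Filter Topology
open scoped ENNReal

noncomputable section

namespace ThinGraph

/-! ### Weak directional derivatives -/

section WeakDirDeriv

variable {E : Type*} [NormedAddCommGroup E] [NormedSpace ℝ E]

/-! Let `u` belong to `H1Xi Y`. Since its weak horizontal derivatives vanish, mollification gives a
representative that is locally constant in horizontal directions. The horizontal sections of a piece
are connected, so on each piece `u` is a function `f` of the height alone. Weak derivatives commute,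
so `∂u/∂y` has zero horizontal derivatives too and is a function `g` of the height
(`exists_ae_eq_comp_snd`). Testing on small boxes (ball times interval) with products of a
normalised bump and a one-variable test function gives `f' = g` weakly. Projection to the height
pushes Lebesgue measure on a piece forward to `p dy` (`map_snd_restrict_piece`), and this matches
the norms.

It remains to see what happens between slabs. If a ball in `Y` meets two consecutive pieces, its
intersection with each slab is convex, hence inside a single piece. So around a point of the
interface there is a box whose lower half lies in one piece and whose upper half lies in the other
(`Junction`). There `u` is a weakly differentiable function of the height across the interface. In
one variable such a function is a primitive of its derivative, hence continuous, and this is the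
continuity condition. Conversely, the continuity condition lets the two primitives glue into one
(`HasWeakDirDeriv.glue`). Every point of `Y` lies in a piece or in a junction box, so the function
assembled from a family in the graph space is locally weakly differentiable with zero horizontal
gradient, and a partition of unity makes this global.

The relation `Represents` between functions and families is additive, homogeneous and norm
preserving, so a function has at most one family. Existence in both directions turns the relation
into the isometry `T`. -/

theorem IsTest.mono {S T : Set E} {η : E → ℝ} (h : IsTest S η) (hST : S ⊆ T) : IsTest T η :=
  ⟨h.smooth, h.compact, h.support.trans hST⟩

theorem IsTest.eq_zero {S : Set E} {η : E → ℝ} (h : IsTest S η) {q : E} (hq : q ∉ S) : η q = 0 :=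
  image_eq_zero_of_notMem_tsupport fun hq' => hq (h.support hq')

theorem IsTest.fderiv {S : Set E} {η : E → ℝ} (h : IsTest S η) (v : E) :
    IsTest S (fun q => fderiv ℝ η q v) where
  smooth := (h.smooth.fderiv_right (m := (⊤ : ℕ∞)) (by simp)).clm_apply contDiff_const
  compact := h.compact.fderiv_apply ℝ v
  support := (tsupport_fderiv_apply_subset ℝ v).trans h.support

theorem IsTest.mul_left {S T : Set E} {η χ : E → ℝ} (h : IsTest S η)
    (hχ : ContDiff ℝ (⊤ : ℕ∞) χ) (hT : tsupport χ ⊆ T) : IsTest (S ∩ T) (fun q => χ q * η q) where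
  smooth := hχ.mul h.smooth
  compact := h.compact.mul_left
  support := subset_inter
    ((closure_mono (Function.support_mul_subset_right _ _)).trans h.support)
    ((closure_mono (Function.support_mul_subset_left _ _)).trans hT)

variable [MeasurableSpace E]

/-- `g` is the weak derivative of `u` in the direction `v` on `S`. -/
def HasWeakDirDeriv (μ : Measure E) (S : Set E) (v : E) (u g : E → ℝ) : Prop :=
  ∀ η, IsTest S η → ∫ q, u q * fderiv ℝ η q v ∂μ = -∫ q, g q * η q ∂μ

variable {μ : Measure E} {S T : Set E} {v : E} {u g u' g' : E → ℝ}

/-- The test function vanishes off `S`. This is why `HasWeakDirDeriv` can integrate over the whole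
space, which makes it evidently monotone in `S`. -/
theorem IsTest.setIntegral_mul {η : E → ℝ} (h : IsTest S η) (u : E → ℝ) :
    ∫ q in S, u q * η q ∂μ = ∫ q, u q * η q ∂μ :=
  setIntegral_eq_integral_of_forall_compl_eq_zero fun q hq => by rw [h.eq_zero hq, mul_zero]

theorem IsTest.integrable_mul [OpensMeasurableSpace E] {η : E → ℝ} (h : IsTest S η)
    (hu : IntegrableOn u S μ) : Integrable (fun q => u q * η q) μ := by
  rw [← integrableOn_iff_integrable_of_support_subset (s := S)]
  · obtain ⟨C, hC⟩ := h.smooth.continuous.bounded_above_of_compact_support h.compact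
    exact Integrable.mul_bdd (c := C) hu h.smooth.continuous.measurable.aestronglyMeasurable
      (Eventually.of_forall hC)
  · intro q hq
    by_contra hqS
    exact hq (by simp [h.eq_zero hqS])

theorem hasWeakDirDeriv_iff :
    HasWeakDirDeriv μ S v u g ↔ ∀ η, IsTest S η →
      ∫ q in S, u q * fderiv ℝ η q v ∂μ = -∫ q in S, g q * η q ∂μ := by
  refine forall₂_congr fun η hη => ?_
  rw [hη.setIntegral_mul, (hη.fderiv v).setIntegral_mul]

theorem HasWeakDirDeriv.mono (h : HasWeakDirDeriv μ T v u g) (hST : S ⊆ T) :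
    HasWeakDirDeriv μ S v u g := fun η hη => h η (hη.mono hST)

theorem HasWeakDirDeriv.congr (h : HasWeakDirDeriv μ S v u g) (hu : u =ᵐ[μ.restrict S] u')
    (hg : g =ᵐ[μ.restrict S] g') : HasWeakDirDeriv μ S v u' g' := by
  rw [hasWeakDirDeriv_iff] at h ⊢
  intro η hη
  rw [integral_congr_ae (g := fun q => u q * _root_.fderiv ℝ η q v),
    integral_congr_ae (f := fun q => g' q * η q) (g := fun q => g q * η q)]
  · exact h η hη
  · filter_upwards [hg] with q hq
    rw [hq]
  · filter_upwards [hu] with q hq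
    rw [hq]

/-- The mixed weak derivatives commute: if `∂_v u = 0` weakly then `∂_v (∂_w u) = 0` weakly. -/
theorem HasWeakDirDeriv.deriv_eq_zero {w : E} (hv : HasWeakDirDeriv μ S v u 0)
    (hw : HasWeakDirDeriv μ S w u g) : HasWeakDirDeriv μ S v g 0 := by
  intro η hη
  -- Both `∂_v η` and `∂_w η` are test functions; the two identities are then compared through the
  -- symmetry of the second derivative of `η`.
  have h1 := hw _ (hη.fderiv v)
  have h2 := hv _ (hη.fderiv w)
  have key : ∀ q, _root_.fderiv ℝ (fun q => _root_.fderiv ℝ η q v) q w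
      = _root_.fderiv ℝ (fun q => _root_.fderiv ℝ η q w) q v := by
    intro q
    have hd : DifferentiableAt ℝ (_root_.fderiv ℝ η) q :=
      ((hη.smooth.fderiv_right (m := (⊤ : ℕ∞)) (by simp)).differentiable (by simp)) q
    have hs : IsSymmSndFDerivAt ℝ η q :=
      (hη.smooth.contDiffAt).isSymmSndFDerivAt (by
        rw [minSmoothness_of_isRCLikeNormedField]
        exact WithTop.coe_le_coe.2 (le_top : (2 : ℕ∞) ≤ ⊤))
    rw [fderiv_clm_apply hd (differentiableAt_const v),
      fderiv_clm_apply hd (differentiableAt_const w)]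
    simp [hs.eq w v]
  simp only [key] at h1
  rw [h1] at h2
  simpa using h2

/-- Being a weak derivative is a local property. -/
theorem HasWeakDirDeriv.of_locally [BorelSpace E] [FiniteDimensional ℝ E]
    (hu : IntegrableOn u S μ) (hg : IntegrableOn g S μ)
    (h : ∀ q ∈ S, ∃ O, IsOpen O ∧ q ∈ O ∧ HasWeakDirDeriv μ O v u g) :
    HasWeakDirDeriv μ S v u g := by
  intro η hη
  choose! O hO hqO hW using h
  -- A partition of unity on the support of `η`, subordinate to the good neighbourhoods, splits `η`
  -- into finitely many test functions, each supported in one of them.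
  obtain ⟨f, hf⟩ := SmoothPartitionOfUnity.exists_isSubordinate (modelWithCornersSelf ℝ E)
    (isClosed_tsupport η) (fun q : S => O q) (fun q => hO q q.2)
    (fun q hq => mem_iUnion.2 ⟨⟨q, hη.support hq⟩, hqO q (hη.support hq)⟩)
  have hfin := f.locallyFinite.finite_nonempty_inter_compact hη.compact
  have hsum : ∀ q, η q = ∑ i ∈ hfin.toFinset, f i q * η q := by
    intro q
    rw [← Finset.sum_mul]
    by_cases hq : q ∈ tsupport η
    · rw [← finsum_eq_sum_of_support_subset, f.sum_eq_one hq, one_mul]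
      intro i hi
      simp only [Finite.coe_toFinset, mem_ofPred_eq]
      exact ⟨q, hi, hq⟩
    · rw [image_eq_zero_of_notMem_tsupport hq, mul_zero]
  have htest : ∀ i : S, IsTest (S ∩ O i) (fun q => f i q * η q) := fun i =>
    hη.mul_left ((f i).contMDiff.contDiff) (hf i)
  have hsumd : ∀ q, _root_.fderiv ℝ η q v
      = ∑ i ∈ hfin.toFinset, _root_.fderiv ℝ (fun q => f i q * η q) q v := by
    intro q
    conv_lhs => rw [show η = fun q => ∑ i ∈ hfin.toFinset, f i q * η q from funext hsum]
    rw [fderiv_fun_sum fun i _ => ((htest i).smooth.differentiable (by simp)) q]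
    simp
  have e1 : ∀ q, u q * _root_.fderiv ℝ η q v
      = ∑ i ∈ hfin.toFinset, u q * _root_.fderiv ℝ (fun q => f i q * η q) q v := fun q => by
    rw [hsumd, Finset.mul_sum]
  have e2 : ∀ q, g q * η q = ∑ i ∈ hfin.toFinset, g q * (f i q * η q) := fun q => by
    rw [← Finset.mul_sum, ← hsum]
  simp only [e1, e2]
  rw [integral_finsetSum, integral_finsetSum, ← Finset.sum_neg_distrib]
  · exact Finset.sum_congr rfl fun i _ => hW i i.2 _ ((htest i).mono inter_subset_right)
  · exact fun i _ => ((htest i).mono inter_subset_left).integrable_mul hg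
  · exact fun i _ => (((htest i).mono inter_subset_left).fderiv v).integrable_mul hu

/-- A function whose weak derivatives in the directions of a set `V` vanish has a representative
which is locally constant in these directions. -/
theorem exists_locally_const_of_hasWeakDirDeriv_zero [BorelSpace E] [FiniteDimensional ℝ E]
    [μ.IsAddHaarMeasure] (hS : IsOpen S) (hu : IntegrableOn u S μ) {V : Set E}
    (h : ∀ v ∈ V, HasWeakDirDeriv μ S v u 0) :
    ∃ U : E → ℝ, U =ᵐ[μ.restrict S] u ∧ ∀ q ∈ S, ∃ r > 0, ∀ x ∈ Metric.ball q r, ∀ v ∈ V,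
      x + v ∈ Metric.ball q r → U (x + v) = U x := by
  classical
  -- Mollifiers with radii tending to 0. The fixed ratio 2 of outer to inner radius is what the a.e.
  -- convergence of the convolutions requires.
  let φ : ℕ → ContDiffBump (0 : E) := fun n =>
    ⟨1 / (2 * (n + 1)), 1 / (n + 1), by positivity, by gcongr; linarith⟩
  have hφ0 : Tendsto (fun n => (φ n).rOut) atTop (𝓝 0) := tendsto_one_div_add_atTop_nhds_zero_nat
  have hφ2 : ∀ n, (φ n).rOut ≤ 2 * (φ n).rIn := by
    intro n
    change (1 : ℝ) / (n + 1) ≤ 2 * (1 / (2 * (n + 1)))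
    apply le_of_eq; field_simp
  set u0 : E → ℝ := S.indicator u with hu0
  have hi : LocallyIntegrable u0 μ :=
    ((integrable_indicator_iff hS.measurableSet).2 hu).locallyIntegrable
  let w : ℕ → E → ℝ := fun n =>
    convolution ((φ n).normed μ) u0 (ContinuousLinearMap.lsmul ℝ ℝ) μ
  have hw : ∀ᵐ x ∂μ, Tendsto (fun n => w n x) atTop (𝓝 (u0 x)) :=
    ContDiffBump.ae_convolution_tendsto_right_of_locallyIntegrable hφ0
      (Eventually.of_forall hφ2) hi
  -- Where the kernel centred at `x` is supported in `S`, it is a test function, and the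
  -- `v`-derivative of the mollification is, up to sign, the integral of `u` against the derivative
  -- of that test function, which is zero.
  have hder : ∀ n x, ∀ v ∈ V, Metric.closedBall x (φ n).rOut ⊆ S → ∃ D : E →L[ℝ] ℝ,
      HasFDerivAt (w n) D x ∧ D v = 0 := by
    intro n x v hv hx
    refine ⟨_, ((φ n).hasCompactSupport_normed).hasFDerivAt_convolution_left
      (ContinuousLinearMap.lsmul ℝ ℝ) (φ n).contDiff_normed hi x, ?_⟩
    have hc : HasCompactSupport (fderiv ℝ ((φ n).normed μ)) :=
      (φ n).hasCompactSupport_normed.fderiv ℝ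
    have hcc : Continuous (fderiv ℝ ((φ n).normed μ)) :=
      (φ n).contDiff_normed.continuous_fderiv (n := 1) one_ne_zero
    have hex := hc.convolutionExists_left ((ContinuousLinearMap.lsmul ℝ ℝ).precompL E) hcc hi x
    have ht : IsTest S (fun t => (φ n).normed μ (x - t)) := by
      have hsupp : tsupport (fun t => (φ n).normed μ (x - t))
          ⊆ Metric.closedBall x (φ n).rOut := by
        refine closure_minimal ?_ Metric.isClosed_closedBall
        intro t ht
        have : x - t ∈ Function.support ((φ n).normed μ) := ht
        rw [(φ n).support_normed_eq] at this
        rw [Metric.mem_closedBall, dist_comm, dist_eq_norm]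
        simpa using (mem_ball_zero_iff.1 this).le
      refine ⟨(φ n).contDiff_normed.comp (contDiff_const.sub contDiff_id), ?_, hsupp.trans hx⟩
      exact HasCompactSupport.of_support_subset_isCompact
        (isCompact_closedBall x (φ n).rOut) (subset_tsupport _ |>.trans hsupp)
    have h0 := h v hv _ ht
    have hd : ∀ t, fderiv ℝ (fun t => (φ n).normed μ (x - t)) t v
        = - fderiv ℝ ((φ n).normed μ) (x - t) v := by
      intro t
      have h1 : HasFDerivAt ((φ n).normed μ) (fderiv ℝ ((φ n).normed μ) (x - t)) (x - t) :=
        ((φ n).contDiff_normed.differentiable (n := 1) one_ne_zero _).hasFDerivAt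
      have h2 : HasFDerivAt (fun t => x - t) (-ContinuousLinearMap.id ℝ E) t := by
        simpa using (hasFDerivAt_id t).const_sub x
      rw [show (fun t => (φ n).normed μ (x - t)) = (φ n).normed μ ∘ fun t => x - t from rfl,
        (h1.comp t h2).fderiv]
      simp
    rw [convolution_def, ContinuousLinearMap.integral_apply hex]
    simp only [ContinuousLinearMap.precompL_apply, ContinuousLinearMap.lsmul_apply, smul_eq_mul]
    rw [← integral_sub_left_eq_self _ μ x]
    simp only [sub_sub_cancel]
    have e : ∀ t, fderiv ℝ ((φ n).normed μ) (x - t) v * u0 t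
        = -(S.indicator (fun t => u t * fderiv ℝ (fun t => (φ n).normed μ (x - t)) t v) t) := by
      intro t
      rw [hu0]
      by_cases htS : t ∈ S
      · simp only [indicator_of_mem htS, hd]; ring
      · simp [indicator_of_notMem htS]
    simp only [e]
    rw [integral_neg, integral_indicator hS.measurableSet, (ht.fderiv v).setIntegral_mul, h0]
    simp
  refine ⟨fun x => limUnder atTop (fun n => w n x), ?_, ?_⟩
  · filter_upwards [ae_restrict_of_ae hw, ae_restrict_mem hS.measurableSet] with x hx hxS
    rw [hx.limUnder_eq, hu0, indicator_of_mem hxS]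
  · intro q hq
    obtain ⟨r, hr, hrS⟩ := Metric.isOpen_iff.1 hS q hq
    -- With half the radius, kernels of radius below `r / 2` centred in the ball stay inside `S`.
    refine ⟨r / 2, by positivity, fun x hx v hv hxv => ?_⟩
    have hev : ∀ᶠ n in atTop, (φ n).rOut < r / 2 := hφ0.eventually (gt_mem_nhds (by positivity))
    -- The two sequences eventually coincide, so their `limUnder` agree even at points where they do
    -- not converge. Hence the equality holds everywhere, not merely a.e.
    have heq : (fun n => w n (x + v)) =ᶠ[atTop] fun n => w n x := by
      filter_upwards [hev] with n hn
      have hline : ∀ t ∈ Icc (0 : ℝ) 1, HasDerivAt (fun t : ℝ => w n (x + t • v)) 0 t := by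
        intro t ht
        have hmem : x + t • v ∈ Metric.ball q (r / 2) :=
          (convex_ball q (r / 2)).add_smul_mem hx hxv ht
        obtain ⟨D, hD, hDv⟩ := hder n (x + t • v) v hv (by
          refine Subset.trans (fun z hz => ?_) hrS
          rw [Metric.mem_ball] at hmem ⊢
          rw [Metric.mem_closedBall] at hz
          linarith [dist_triangle z (x + t • v) q])
        have hl : HasDerivAt (fun t : ℝ => x + t • v) v t := by
          simpa using ((hasDerivAt_id t).smul_const v).const_add x
        simpa [hDv] using! hD.comp_hasDerivAt t hl
      have := constant_of_has_deriv_right_zero (f := fun t : ℝ => w n (x + t • v)) (a := 0) (b := 1)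
        (fun t ht => (hline t ht).continuousAt.continuousWithinAt)
        (fun t ht => (hline t (Ico_subset_Icc_self ht)).hasDerivWithinAt) 1 (by simp)
      simpa using this
    change lim (map _ atTop) = lim (map _ atTop)
    rw [Filter.map_congr heq]

end WeakDirDeriv

/-! ### Weak derivatives on intervals -/

section Interval

variable {a b h : ℝ} {f g : ℝ → ℝ}

theorem hasWeakDeriv_iff :
    HasWeakDeriv a b f g ↔ HasWeakDirDeriv volume (Ioo a b) 1 f g := by
  rw [hasWeakDirDeriv_iff]
  rfl

/-- Integration by parts for absolutely continuous functions, on an interval at whose ends `η`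
vanishes. -/
theorem hasWeakDirDeriv_primitive (hg : Integrable g) (x₀ c : ℝ) :
    HasWeakDirDeriv volume univ 1 (fun y => c + ∫ t in x₀..y, g t) g := by
  intro η hη
  obtain ⟨R, hR⟩ := hη.compact.isBounded.subset_closedBall x₀
  -- The absolute value covers a negative `R`, possible when the support is empty; the extra 1 puts
  -- the support in the open interval.
  set A := x₀ - (|R| + 1) with hA
  set B := x₀ + (|R| + 1) with hB
  have hR0 := abs_nonneg R
  have hη' : IsTest (Ioo A B) η := by
    refine ⟨hη.smooth, hη.compact, fun y hy => ?_⟩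
    have h1 := hR hy
    rw [Metric.mem_closedBall, Real.dist_eq] at h1
    have h2 := abs_le.1 (h1.trans (le_abs_self R))
    constructor <;> linarith [h2.1, h2.2]
  have hAB : A ≤ B := by linarith
  have hx₀ : x₀ ∈ uIcc A B := by
    rw [uIcc_of_le hAB]; constructor <;> linarith
  have hloc : LocallyIntegrable g := hg.locallyIntegrable
  have hF : AbsolutelyContinuousOnInterval (fun y => c + ∫ t in x₀..y, g t) A B :=
    (contDiffOn_const.absolutelyContinuousOnInterval).fun_add
      (hg.intervalIntegrable.absolutelyContinuousOnInterval_intervalIntegral hx₀)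
  have hηac : AbsolutelyContinuousOnInterval η A B :=
    ((hη.smooth.of_le (by exact_mod_cast le_top)).contDiffOn).absolutelyContinuousOnInterval
  have key := hF.integral_mul_deriv_eq_deriv_mul hηac
  rw [hη'.eq_zero (q := A) (by simp), hη'.eq_zero (q := B) (by simp)] at key
  have e1 : ∫ y, (c + ∫ t in x₀..y, g t) * fderiv ℝ η y 1
      = ∫ y in A..B, (c + ∫ t in x₀..y, g t) * deriv η y := by
    rw [intervalIntegral.integral_of_le hAB]
    refine (setIntegral_eq_integral_of_forall_compl_eq_zero fun y hy => ?_).symm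
    rw [(hη'.fderiv 1).eq_zero fun h => hy (Ioo_subset_Ioc_self h), mul_zero]
  have e2 : ∫ y, g y * η y = ∫ y in A..B, deriv (fun y => c + ∫ t in x₀..y, g t) y * η y := by
    rw [intervalIntegral.integral_of_le hAB,
      ← setIntegral_eq_integral_of_forall_compl_eq_zero (s := Ioc A B)]
    · refine integral_congr_ae (ae_restrict_of_ae ?_)
      filter_upwards [_root_.LocallyIntegrable.ae_hasDerivAt_integral hloc] with y hy
      simp only [((hy x₀).const_add c).deriv]
    · intro y hy
      rw [hη'.eq_zero fun h => hy (Ioo_subset_Ioc_self h), mul_zero]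
  rw [e1, e2, key]
  ring

theorem exists_ae_eq_const_of_hasWeakDirDeriv_zero (hf : IntegrableOn f (Ioo a b))
    (h : HasWeakDirDeriv volume (Ioo a b) 1 f 0) :
    ∃ c, ∀ᵐ y ∂(volume.restrict (Ioo a b)), f y = c := by
  -- By linearity the derivative vanishes in every direction `v`, so the representative below is
  -- locally constant, and the interval is connected.
  have hV : ∀ v ∈ (univ : Set ℝ), HasWeakDirDeriv volume (Ioo a b) v f 0 := by
    intro v _ η hη
    have := h η hη
    have e : ∀ q, f q * fderiv ℝ η q v = v * (f q * fderiv ℝ η q 1) := fun q => by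
      have : fderiv ℝ η q v = v * fderiv ℝ η q 1 := by
        conv_lhs => rw [show v = v • (1 : ℝ) by simp]
        rw [map_smul, smul_eq_mul]
      rw [this]; ring
    simp only [e]
    rw [integral_const_mul, this]
    simp
  obtain ⟨U, hU, hloc⟩ := exists_locally_const_of_hasWeakDirDeriv_zero isOpen_Ioo hf hV
  rcases (Ioo a b).eq_empty_or_nonempty with he | ⟨x, hx⟩
  · exact ⟨0, by simp [he]⟩
  · refine ⟨U x, ?_⟩
    filter_upwards [hU, ae_restrict_mem measurableSet_Ioo] with y hy hyI
    rw [← hy]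
    refine isPreconnected_Ioo.induction₂ (fun y x => U y = U x) (fun z hz => ?_)
      (fun _ _ _ _ _ _ => Eq.trans) (fun _ _ _ _ => Eq.symm) hyI hx
    obtain ⟨r, hr, hrU⟩ := hloc z hz
    filter_upwards [mem_nhdsWithin_of_mem_nhds (Metric.ball_mem_nhds z hr)] with y hy
    have := hrU z (Metric.mem_ball_self hr) (y - z) (mem_univ _) (by simpa using hy)
    simpa using this.symm

/-- The difference between `f` and a primitive of `g` has zero weak derivative, hence is a.e.
constant. -/
theorem exists_ae_eq_primitive (hf : IntegrableOn f (Ioo a b)) (hg : Integrable g)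
    (h : HasWeakDirDeriv volume (Ioo a b) 1 f g) (x₀ : ℝ) :
    ∃ c, ∀ᵐ y ∂(volume.restrict (Ioo a b)), f y = c + ∫ t in x₀..y, g t := by
  have hP : IntegrableOn (fun y => 0 + ∫ t in x₀..y, g t) (Ioo a b) :=
    ((continuous_const.add (intervalIntegral.continuous_primitive
      (fun _ _ => hg.intervalIntegrable) x₀)).integrableOn_Icc).mono_set Ioo_subset_Icc_self
  obtain ⟨c, hc⟩ := exists_ae_eq_const_of_hasWeakDirDeriv_zero (hf.sub hP) (by
    intro η hη
    have h1 := h η hη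
    have h2 := hasWeakDirDeriv_primitive hg x₀ 0 η (hη.mono (subset_univ _))
    simp only [Pi.sub_apply, sub_mul]
    rw [integral_sub ((hη.fderiv 1).integrable_mul hf) ((hη.fderiv 1).integrable_mul hP), h1, h2]
    simp)
  refine ⟨c, ?_⟩
  filter_upwards [hc] with y hy
  rw [← hy]
  simp

/-- Continuous functions that agree a.e. on a nondegenerate interval agree up to its end points.
This is how end-point values are read off. -/
theorem eqOn_primitive_of_ae_eq {F : ℝ → ℝ} {x₀ c : ℝ} (hab : a < b) (hg : Integrable g)
    (hF : ContinuousOn F (Icc a b)) (hFf : ∀ᵐ y ∂(volume.restrict (Ioo a b)), F y = f y)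
    (hf : ∀ᵐ y ∂(volume.restrict (Ioo a b)), f y = c + ∫ t in x₀..y, g t) :
    EqOn F (fun y => c + ∫ t in x₀..y, g t) (Icc a b) := by
  refine Measure.eqOn_Icc_of_ae_eq volume hab.ne ?_ hF (continuous_const.add
    (intervalIntegral.continuous_primitive (fun _ _ => hg.intervalIntegrable) x₀)).continuousOn
  rw [← Measure.restrict_congr_set Ioo_ae_eq_Icc]
  filter_upwards [hFf, hf] with y h1 h2
  rw [h1, h2]

theorem ae_restrict_Ioo_of_split {P : ℝ → Prop} (h1 : ∀ᵐ y ∂(volume.restrict (Ioo a h)), P y)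
    (h2 : ∀ᵐ y ∂(volume.restrict (Ioo h b)), P y) :
    ∀ᵐ y ∂(volume.restrict (Ioo a b)), P y := by
  rw [ae_restrict_iff' measurableSet_Ioo] at *
  filter_upwards [h1, h2, Measure.ae_ne volume h] with y h1 h2 h3 hy
  rcases lt_or_gt_of_ne h3 with h3 | h3
  · exact h1 ⟨hy.1, h3⟩
  · exact h2 ⟨h3, hy.2⟩

variable {F₁ F₂ : ℝ → ℝ}

/-- Two continuous functions, with values agreeing at `h`, glue to a weakly differentiable one. -/
theorem HasWeakDirDeriv.glue (hah : a < h) (hhb : h < b) (hf : IntegrableOn f (Ioo a b))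
    (hg : IntegrableOn g (Ioo a b)) (h1 : HasWeakDirDeriv volume (Ioo a h) 1 f g)
    (h2 : HasWeakDirDeriv volume (Ioo h b) 1 f g)
    (hF₁ : ContinuousOn F₁ (Icc a h)) (hF₂ : ContinuousOn F₂ (Icc h b))
    (hf₁ : ∀ᵐ y ∂(volume.restrict (Ioo a h)), F₁ y = f y)
    (hf₂ : ∀ᵐ y ∂(volume.restrict (Ioo h b)), F₂ y = f y) (hF : F₁ h = F₂ h) :
    HasWeakDirDeriv volume (Ioo a b) 1 f g := by
  -- Extending `g` by zero makes its primitive a continuous function on all of `ℝ`.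
  have hg' : Integrable ((Ioo a b).indicator g) := (integrable_indicator_iff measurableSet_Ioo).2 hg
  have hae : g =ᵐ[volume.restrict (Ioo a b)] (Ioo a b).indicator g :=
    (indicator_ae_eq_restrict measurableSet_Ioo).symm
  have s1 : Ioo a h ⊆ Ioo a b := Ioo_subset_Ioo_right hhb.le
  have s2 : Ioo h b ⊆ Ioo a b := Ioo_subset_Ioo_left hah.le
  -- Both primitives are based at `h`, so their constants are the values `F₁ h` and `F₂ h`.
  obtain ⟨c₁, hc₁⟩ := exists_ae_eq_primitive (hf.mono_set s1) hg'
    (h1.congr ae_eq_rfl (ae_restrict_of_ae_restrict_of_subset s1 hae)) h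
  obtain ⟨c₂, hc₂⟩ := exists_ae_eq_primitive (hf.mono_set s2) hg'
    (h2.congr ae_eq_rfl (ae_restrict_of_ae_restrict_of_subset s2 hae)) h
  have e1 := eqOn_primitive_of_ae_eq hah hg' hF₁ hf₁ hc₁ (right_mem_Icc.2 hah.le)
  have e2 := eqOn_primitive_of_ae_eq hhb hg' hF₂ hf₂ hc₂ (left_mem_Icc.2 hhb.le)
  simp only [intervalIntegral.integral_same, add_zero] at e1 e2
  have hc : c₁ = c₂ := by rw [← e1, ← e2, hF]
  subst hc
  exact ((hasWeakDirDeriv_primitive hg' h c₁).mono (subset_univ _)).congr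
    (EventuallyEq.symm (ae_restrict_Ioo_of_split hc₁ hc₂)) hae.symm

/-- The continuous representatives on both sides of `h` of a weakly differentiable function agree
at `h`. -/
theorem HasWeakDirDeriv.eq_of_continuousOn (hah : a < h) (hhb : h < b)
    (hf : IntegrableOn f (Ioo a b)) (hg : IntegrableOn g (Ioo a b))
    (hfg : HasWeakDirDeriv volume (Ioo a b) 1 f g)
    (hF₁ : ContinuousOn F₁ (Icc a h)) (hF₂ : ContinuousOn F₂ (Icc h b))
    (hf₁ : ∀ᵐ y ∂(volume.restrict (Ioo a h)), F₁ y = f y)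
    (hf₂ : ∀ᵐ y ∂(volume.restrict (Ioo h b)), F₂ y = f y) : F₁ h = F₂ h := by
  have hg' : Integrable ((Ioo a b).indicator g) := (integrable_indicator_iff measurableSet_Ioo).2 hg
  have hae : g =ᵐ[volume.restrict (Ioo a b)] (Ioo a b).indicator g :=
    (indicator_ae_eq_restrict measurableSet_Ioo).symm
  obtain ⟨c, hc⟩ := exists_ae_eq_primitive hf hg' (hfg.congr ae_eq_rfl hae) h
  rw [eqOn_primitive_of_ae_eq hah hg' hF₁ hf₁ (ae_restrict_of_ae_restrict_of_subset
      (Ioo_subset_Ioo_right hhb.le) hc) (right_mem_Icc.2 hah.le),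
    eqOn_primitive_of_ae_eq hhb hg' hF₂ hf₂ (ae_restrict_of_ae_restrict_of_subset
      (Ioo_subset_Ioo_left hah.le) hc) (left_mem_Icc.2 hhb.le)]

end Interval

/-! ### Weak derivatives on boxes -/

section Box

variable {N : ℕ} {B : Set (Hor N)} {J : Set ℝ} {f g : ℝ → ℝ}

theorem IntegrableOn.comp_snd_box (hB : volume B ≠ ⊤) (hf : IntegrableOn f J) :
    IntegrableOn (fun q : Pt N => f q.2) (B ×ˢ J) := by
  have : IsFiniteMeasure ((volume : Measure (Hor N)).restrict B) :=
    ⟨by simpa using hB.lt_top⟩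
  rw [IntegrableOn, Measure.volume_eq_prod, ← Measure.prod_restrict]
  exact Integrable.comp_snd hf _

theorem IsTest.comp_vert {S : Set (Pt N)} {η : Pt N → ℝ} (h : IsTest S η) (ξ : Hor N) :
    IsTest {y | (ξ, y) ∈ S} (fun y => η (ξ, y)) where
  smooth := h.smooth.comp (contDiff_prodMk_right ξ)
  compact := HasCompactSupport.of_support_subset_isCompact (h.compact.image continuous_snd)
    fun y hy => ⟨(ξ, y), subset_tsupport η hy, rfl⟩
  support := fun _ hy => h.support
    (tsupport_comp_subset_preimage (f := fun y => (ξ, y)) η (by fun_prop) hy)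

theorem IsTest.comp_hor {S : Set (Pt N)} {η : Pt N → ℝ} (h : IsTest S η) (y : ℝ) :
    IsTest {ξ | (ξ, y) ∈ S} (fun ξ => η (ξ, y)) where
  smooth := h.smooth.comp (contDiff_prodMk_left y)
  compact := HasCompactSupport.of_support_subset_isCompact (h.compact.image continuous_fst)
    fun ξ hξ => ⟨(ξ, y), subset_tsupport η hξ, rfl⟩
  support := fun _ hy => h.support
    (tsupport_comp_subset_preimage (f := fun ξ => (ξ, y)) η (by fun_prop) hy)

theorem fderiv_comp_vert {η : Pt N → ℝ} (h : Differentiable ℝ η) (ξ : Hor N) (y : ℝ) :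
    fderiv ℝ (fun y => η (ξ, y)) y 1 = fderiv ℝ η (ξ, y) (0, 1) := by
  have := (h (ξ, y)).hasFDerivAt.comp y (hasFDerivAt_prodMk_right ξ y)
  rw [show (fun y => η (ξ, y)) = η ∘ fun y => (ξ, y) from rfl, this.fderiv]
  simp

theorem fderiv_comp_hor {η : Pt N → ℝ} (h : Differentiable ℝ η) (ξ v : Hor N) (y : ℝ) :
    fderiv ℝ (fun ξ => η (ξ, y)) ξ v = fderiv ℝ η (ξ, y) (v, 0) := by
  have := (h (ξ, y)).hasFDerivAt.comp (f := fun ξ : Hor N => (ξ, y)) ξ (hasFDerivAt_prodMk_left ξ y)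
  rw [show (fun ξ => η (ξ, y)) = η ∘ fun ξ => (ξ, y) from rfl, this.fderiv]
  simp

/-- Integration by parts against the constant function 1. -/
theorem IsTest.integral_fderiv {F : Type*} [NormedAddCommGroup F] [NormedSpace ℝ F]
    [MeasurableSpace F] [BorelSpace F] [FiniteDimensional ℝ F] {μ : Measure F}
    [μ.IsAddHaarMeasure] {S : Set F} {η : F → ℝ} (h : IsTest S η) (v : F) :
    ∫ q, _root_.fderiv ℝ η q v ∂μ = 0 := by
  have i1 := (h.fderiv v).smooth.continuous.integrable_of_hasCompactSupport (μ := μ)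
    (h.fderiv v).compact
  have i2 := h.smooth.continuous.integrable_of_hasCompactSupport (μ := μ) h.compact
  have := integral_mul_fderiv_eq_neg_fderiv_mul_of_integrable (μ := μ) (f := fun _ : F => (1 : ℝ))
    (g := η) (v := v) (by simp) (by simpa using i1) (by simpa using i2)
    (fun x _ => differentiableAt_const _) (fun x _ => (h.smooth.differentiable (by simp)) x)
  simpa using this

/-- Fubini: vertical slices of a test function are test functions on `J`. -/
theorem HasWeakDirDeriv.box_vert (hB : volume B ≠ ⊤) (hf : IntegrableOn f J)
    (hg : IntegrableOn g J) (h : HasWeakDirDeriv volume J 1 f g) :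
    HasWeakDirDeriv volume (B ×ˢ J) (0, 1) (fun q : Pt N => f q.2) (fun q => g q.2) := by
  intro η hη
  have i1 := (hη.fderiv (0, 1)).integrable_mul (IntegrableOn.comp_snd_box hB hf)
  have i2 := hη.integrable_mul (IntegrableOn.comp_snd_box hB hg)
  rw [Measure.volume_eq_prod] at i1 i2 ⊢
  rw [integral_prod _ i1, integral_prod _ i2, ← integral_neg]
  congr 1 with ξ
  have := h _ ((hη.comp_vert ξ).mono fun y hy => hy.2)
  simpa only [fderiv_comp_vert (hη.smooth.differentiable (by simp))] using this

theorem hasWeakDirDeriv_box_hor (hB : volume B ≠ ⊤) (hf : IntegrableOn f J) (v : Hor N) :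
    HasWeakDirDeriv volume (B ×ˢ J) (v, 0) (fun q : Pt N => f q.2) 0 := by
  intro η hη
  have i1 := (hη.fderiv (v, 0)).integrable_mul (IntegrableOn.comp_snd_box hB hf)
  rw [Measure.volume_eq_prod] at i1 ⊢
  rw [integral_prod_symm _ i1]
  have : ∀ y, ∫ ξ, f y * fderiv ℝ η (ξ, y) (v, 0) = 0 := by
    intro y
    rw [integral_const_mul]
    simp only [← fderiv_comp_hor (hη.smooth.differentiable (by simp))]
    rw [(hη.comp_hor y).integral_fderiv, mul_zero]
  simp [this]

/-- Test with a product of a bump of integral 1 supported in `B` and the given one-variable test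
function; the horizontal factor integrates out. -/
theorem HasWeakDirDeriv.of_box_vert (hB : IsOpen B) (hBne : B.Nonempty)
    (h : HasWeakDirDeriv volume (B ×ˢ J) (0, 1) (fun q : Pt N => f q.2) (fun q => g q.2)) :
    HasWeakDirDeriv volume J 1 f g := by
  intro ψ hψ
  obtain ⟨c, hc⟩ := hBne
  obtain ⟨r, hr, hrB⟩ := Metric.isOpen_iff.1 hB c hc
  let ρ : ContDiffBump c := ⟨r / 4, r / 2, by positivity, by linarith⟩
  have hρs : ContDiff ℝ (⊤ : ℕ∞) (ρ.normed volume) := ρ.contDiff_normed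
  have hη : IsTest (B ×ˢ J) (fun q : Pt N => ρ.normed volume q.1 * ψ q.2) := by
    have hsub : tsupport (fun q : Pt N => ρ.normed volume q.1 * ψ q.2)
        ⊆ Metric.closedBall c (r / 2) ×ˢ tsupport ψ := by
      refine closure_minimal (fun q hq => ?_)
        (Metric.isClosed_closedBall.prod (isClosed_tsupport ψ))
      have h1 : q.1 ∈ Function.support (ρ.normed volume) := left_ne_zero_of_mul hq
      rw [ρ.support_normed_eq] at h1
      exact ⟨Metric.ball_subset_closedBall h1, subset_tsupport _ (right_ne_zero_of_mul hq)⟩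
    refine ⟨(hρs.comp contDiff_fst).mul (hψ.smooth.comp contDiff_snd), ?_, hsub.trans ?_⟩
    · exact HasCompactSupport.of_support_subset_isCompact
        ((isCompact_closedBall c (r / 2)).prod hψ.compact) ((subset_tsupport _).trans hsub)
    · refine prod_mono (Subset.trans (fun z hz => ?_) hrB) hψ.support
      rw [Metric.mem_closedBall] at hz
      rw [Metric.mem_ball]
      linarith
  have h1 := h _ hη
  have e : ∀ q : Pt N, fderiv ℝ (fun q : Pt N => ρ.normed volume q.1 * ψ q.2) q (0, 1)
      = ρ.normed volume q.1 * fderiv ℝ ψ q.2 1 := by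
    rintro ⟨ξ, y⟩
    rw [← fderiv_comp_vert (hη.smooth.differentiable (by simp))]
    simp only
    rw [fderiv_const_mul (hψ.smooth.differentiable (by simp) y)]
    simp
  simp only [e] at h1
  rw [Measure.volume_eq_prod] at h1
  have e1 : ∀ q : Pt N, f q.2 * (ρ.normed volume q.1 * fderiv ℝ ψ q.2 1)
      = ρ.normed volume q.1 * (f q.2 * fderiv ℝ ψ q.2 1) := fun q => by ring
  have e2 : ∀ q : Pt N, g q.2 * (ρ.normed volume q.1 * ψ q.2)
      = ρ.normed volume q.1 * (g q.2 * ψ q.2) := fun q => by ring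
  simp only [e1, e2] at h1
  rw [integral_prod_mul (f := fun ξ => ρ.normed volume ξ) (g := fun y => f y * fderiv ℝ ψ y 1),
    integral_prod_mul (f := fun ξ => ρ.normed volume ξ) (g := fun y => g y * ψ y),
    ρ.integral_normed, one_mul, one_mul] at h1
  exact h1

end Box

/-! ### The pieces of a nice decomposition -/

namespace NiceDecomposition

variable {N : ℕ} {Y : Set (Pt N)} (D : NiceDecomposition Y)

theorem slab_isOpen (hY : IsOpen Y) (a b : ℝ) : IsOpen (slab Y a b) :=
  hY.inter (isOpen_Ioo.preimage continuous_snd)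

theorem exists_piece_eq (s : D.Idx) : ∃ q ∈ slab Y (D.lo s) (D.hi s),
    D.piece s = connectedComponentIn (slab Y (D.lo s) (D.hi s)) q := by
  have : D.comp s.1 s.2 ∈ Set.range (D.comp s.1) := mem_range_self _
  rw [D.range_comp] at this
  exact this

theorem piece_subset_slab (s : D.Idx) : D.piece s ⊆ slab Y (D.lo s) (D.hi s) := by
  obtain ⟨q, _, h⟩ := D.exists_piece_eq s
  rw [h]
  exact connectedComponentIn_subset _ _

theorem piece_subset (s : D.Idx) : D.piece s ⊆ Y := (D.piece_subset_slab s).trans inter_subset_left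

theorem mem_Ioo_of_mem_piece {s : D.Idx} {q : Pt N} (hq : q ∈ D.piece s) :
    q.2 ∈ Ioo (D.lo s) (D.hi s) := (D.piece_subset_slab s hq).2

theorem piece_isOpen (hY : IsOpen Y) (s : D.Idx) : IsOpen (D.piece s) := by
  obtain ⟨q, _, h⟩ := D.exists_piece_eq s
  rw [h]
  exact (slab_isOpen hY _ _).connectedComponentIn

theorem lo_lt_hi (s : D.Idx) : D.lo s < D.hi s := D.a_strictMono s.1.castSucc_lt_succ

theorem subset_piece {s : D.Idx} {C : Set (Pt N)} (hC : IsPreconnected C)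
    (hCs : C ⊆ slab Y (D.lo s) (D.hi s)) (hne : (C ∩ D.piece s).Nonempty) : C ⊆ D.piece s := by
  obtain ⟨q, _, h⟩ := D.exists_piece_eq s
  obtain ⟨x, hxC, hx⟩ := hne
  rw [h] at hx ⊢
  rw [connectedComponentIn_eq hx]
  exact hC.subset_connectedComponentIn hxC hCs

theorem exists_mem_piece (i : Fin D.M) {q : Pt N} (hq : q ∈ Y)
    (hqi : q.2 ∈ Ioo (D.a i.castSucc) (D.a i.succ)) : ∃ s : D.Idx, s.1 = i ∧ q ∈ D.piece s := by
  have hq' : q ∈ slab Y (D.a i.castSucc) (D.a i.succ) := ⟨hq, hqi⟩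
  have : connectedComponentIn (slab Y (D.a i.castSucc) (D.a i.succ)) q ∈ Set.range (D.comp i) := by
    rw [D.range_comp]
    exact ⟨q, hq', rfl⟩
  obtain ⟨j, hj⟩ := this
  refine ⟨⟨i, j⟩, rfl, ?_⟩
  change q ∈ D.comp i j
  rw [hj]
  exact mem_connectedComponentIn hq'

theorem fst_eq_of_mem_Ioo {s t : D.Idx} {y : ℝ} (hs : y ∈ Ioo (D.lo s) (D.hi s))
    (ht : y ∈ Ioo (D.lo t) (D.hi t)) : s.1 = t.1 := by
  have h1 : s.1.castSucc < t.1.succ := D.a_strictMono.lt_iff_lt.1 (hs.1.trans ht.2)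
  have h2 : t.1.castSucc < s.1.succ := D.a_strictMono.lt_iff_lt.1 (ht.1.trans hs.2)
  rw [Fin.lt_def] at h1 h2
  simp only [Fin.val_castSucc, Fin.val_succ] at h1 h2
  exact Fin.ext (by omega)

theorem eq_of_mem_piece {s t : D.Idx} {q : Pt N} (hs : q ∈ D.piece s) (ht : q ∈ D.piece t) :
    s = t := by
  have h := D.fst_eq_of_mem_Ioo (D.mem_Ioo_of_mem_piece hs) (D.mem_Ioo_of_mem_piece ht)
  obtain ⟨i, j⟩ := s
  obtain ⟨i', j'⟩ := t
  obtain rfl : i = i' := h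
  obtain ⟨x, _, hx⟩ := D.exists_piece_eq ⟨i, j⟩
  obtain ⟨z, _, hz⟩ := D.exists_piece_eq ⟨i, j'⟩
  have : D.comp i j = D.comp i j' := by
    change D.piece ⟨i, j⟩ = D.piece ⟨i, j'⟩
    rw [hx] at hs
    rw [hz] at ht
    rw [hx, hz, connectedComponentIn_eq hs, connectedComponentIn_eq ht]
    rfl
  rw [D.comp_injective i this]

theorem exists_height (hY : ∀ q ∈ Y, 0 < q.2) {q : Pt N} (hq : q ∈ Y) :
    ∃ i : Fin D.M, q.2 ∈ Ioc (D.a i.castSucc) (D.a i.succ) := by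
  classical
  -- The slab starts at the largest `a k` strictly below `q.2`, so an interface height is attributed
  -- to the slab beneath it.
  let K : Finset (Fin (D.M + 1)) := Finset.univ.filter fun k => D.a k < q.2
  have hK : K.Nonempty := ⟨0, by simp [K, D.a_zero, hY q hq]⟩
  have hmem := K.max'_mem hK
  have hlt : D.a (K.max' hK) < q.2 := by simpa [K] using hmem
  have hne : K.max' hK ≠ Fin.last D.M := fun h => by
    rw [h] at hlt
    exact lt_asymm hlt (D.height_lt q hq)
  obtain ⟨i, hi⟩ := Fin.exists_castSucc_eq.2 hne
  refine ⟨i, by rwa [hi], ?_⟩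
  by_contra hcon
  have : i.succ ≤ K.max' hK := K.le_max' _ (by simpa [K] using hcon)
  rw [← hi] at this
  exact absurd this (not_le.2 i.castSucc_lt_succ)

/-- Near `q`, at the height where the slab of `s` ends, the set `Y` consists of points of the piece
`s` below and of points of the piece `t` above. -/
def Junction (s t : D.Idx) (q : Pt N) : Prop :=
  q.2 = D.hi s ∧ D.lo t = D.hi s ∧ ∃ r > 0, D.lo s ≤ D.hi s - r ∧ D.hi s + r ≤ D.hi t ∧
    Metric.ball q.1 r ×ˢ Ioo (D.hi s - r) (D.hi s + r) ⊆ Y ∧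
    Metric.ball q.1 r ×ˢ Ioo (D.hi s - r) (D.hi s) ⊆ D.piece s ∧
    Metric.ball q.1 r ×ˢ Ioo (D.hi s) (D.hi s + r) ⊆ D.piece t

theorem lo_eq_hi {s t : D.Idx} (hst : (t.1 : ℕ) = (s.1 : ℕ) + 1) : D.lo t = D.hi s := by
  have : t.1.castSucc = s.1.succ := Fin.ext (by simpa using hst)
  rw [lo, hi, this]

theorem exists_box {C : Set (Pt N)} {q : Pt N} (hC : C ∈ 𝓝 q) {δ : ℝ} (hδ : 0 < δ) :
    ∃ r > 0, r ≤ δ ∧ Metric.ball q.1 r ×ˢ Ioo (q.2 - r) (q.2 + r) ⊆ C := by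
  obtain ⟨r, hr, hrC⟩ := Metric.mem_nhds_iff.1 hC
  refine ⟨min r δ, lt_min hr hδ, min_le_right _ _, Subset.trans ?_ hrC⟩
  rw [← Real.ball_eq_Ioo, ball_prod_same]
  exact Metric.ball_subset_ball (min_le_left _ _)

/-- The part of a convex set in an open slab is convex, hence connected, so it lies in whichever
piece it meets. -/
theorem junction_of_convex {s t : D.Idx} (hst : (t.1 : ℕ) = (s.1 : ℕ) + 1) {C : Set (Pt N)}
    {q : Pt N} (hq : q.2 = D.hi s) (hC : Convex ℝ C) (hCq : C ∈ 𝓝 q) (hCY : C ⊆ Y)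
    (hs : (C ∩ D.piece s).Nonempty) (ht : (C ∩ D.piece t).Nonempty) : D.Junction s t q := by
  have hlt := D.lo_eq_hi hst
  have key : ∀ s : D.Idx, (C ∩ D.piece s).Nonempty →
      C ∩ Prod.snd ⁻¹' Ioo (D.lo s) (D.hi s) ⊆ D.piece s := by
    intro s hs
    refine D.subset_piece (hC.inter ((convex_Ioo _ _).linear_preimage
      (LinearMap.snd ℝ (Hor N) ℝ))).isPreconnected (inter_subset_inter_left _ hCY) ?_
    obtain ⟨x, hxC, hx⟩ := hs
    exact ⟨x, ⟨hxC, D.mem_Ioo_of_mem_piece hx⟩, hx⟩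
  have h1 := D.lo_lt_hi s
  have h2 := D.lo_lt_hi t
  obtain ⟨r, hr, hrδ, hrC⟩ := exists_box hCq
    (δ := min (D.hi s - D.lo s) (D.hi t - D.hi s)) (lt_min (by linarith) (by linarith))
  rw [hq] at hrC
  have h3 := hrδ.trans (min_le_left _ _)
  have h4 := hrδ.trans (min_le_right _ _)
  refine ⟨hq, hlt, r, hr, by linarith, by linarith, hrC.trans hCY, ?_, ?_⟩
  · intro z hz
    refine key s hs ⟨hrC ⟨hz.1, hz.2.1, by linarith [hz.2.2]⟩, ?_, hz.2.2⟩
    linarith [hz.2.1]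
  · intro z hz
    refine key t ht ⟨hrC ⟨hz.1, by linarith [hz.2.1], hz.2.2⟩, ?_, ?_⟩
    · rw [hlt]; exact hz.2.1
    · linarith [hz.2.2]

/-! ### Euclidean balls, joined pieces and junctions. -/

theorem eball_convex (c : Pt N) (r : ℝ) : Convex ℝ (eball c r) := by
  have h1 : ConvexOn ℝ univ (fun q : Pt N => ‖q.1 - c.1‖ ^ 2) := by
    have : ConvexOn ℝ univ (fun x : Hor N => ‖x - c.1‖) := by
      simpa [dist_eq_norm] using convexOn_univ_dist c.1
    exact (this.pow (fun _ _ => norm_nonneg _) 2).comp_linearMap (LinearMap.fst ℝ (Hor N) ℝ)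
  have h2 : ConvexOn ℝ univ (fun q : Pt N => (q.2 - c.2) ^ 2) := by
    have : ConvexOn ℝ univ (fun x : ℝ => ‖x - c.2‖) := by
      simpa [dist_eq_norm] using convexOn_univ_dist c.2
    have h : ConvexOn ℝ univ (fun q : Pt N => ‖q.2 - c.2‖ ^ 2) :=
      (this.pow (fun _ _ => norm_nonneg _) 2).comp_linearMap (LinearMap.snd ℝ (Hor N) ℝ)
    simpa using h
  simpa [eball] using (h1.add h2).convex_lt (r ^ 2)

theorem eball_isOpen (c : Pt N) (r : ℝ) : IsOpen (eball c r) :=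
  isOpen_lt (by fun_prop) continuous_const

theorem Joins.exists_junction {s t : D.Idx} (h : D.Joins s t) : ∃ q, D.Junction s t q := by
  obtain ⟨hst, c, r, hY, ⟨x, hxC, hx⟩, ⟨z, hzC, hz⟩⟩ := h
  have hlt := D.lo_eq_hi hst
  have hx2 := (D.mem_Ioo_of_mem_piece hx).2
  have hz2 := (D.mem_Ioo_of_mem_piece hz).1
  rw [hlt] at hz2
  obtain ⟨q, hqC, hq⟩ : D.hi s ∈ Prod.snd '' eball c r :=
    ((eball_convex c r).isPreconnected.image _ continuous_snd.continuousOn).ordConnected.out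
      ⟨x, hxC, rfl⟩ ⟨z, hzC, rfl⟩ ⟨hx2.le, hz2.le⟩
  exact ⟨q, D.junction_of_convex hst hq (eball_convex c r) ((eball_isOpen c r).mem_nhds hqC) hY
    ⟨x, hxC, hx⟩ ⟨z, hzC, hz⟩⟩

theorem eball_subset (q : Pt N) {r : ℝ} (hr : 0 < r) :
    eball q r ⊆ Metric.ball q.1 r ×ˢ Ioo (q.2 - r) (q.2 + r) := by
  intro z hz
  change ‖z.1 - q.1‖ ^ 2 + (z.2 - q.2) ^ 2 < r ^ 2 at hz
  rw [← Real.ball_eq_Ioo]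
  refine ⟨?_, ?_⟩
  · rw [Metric.mem_ball, dist_eq_norm]
    exact lt_of_pow_lt_pow_left₀ 2 hr.le (by linarith [sq_nonneg (z.2 - q.2)])
  · rw [Metric.mem_ball, Real.dist_eq]
    exact lt_of_pow_lt_pow_left₀ 2 hr.le (by rw [sq_abs]; linarith [sq_nonneg (‖z.1 - q.1‖)])

theorem Junction.joins {s t : D.Idx} {q : Pt N} (h : D.Junction s t q)
    (hst : (t.1 : ℕ) = (s.1 : ℕ) + 1) : D.Joins s t := by
  obtain ⟨hq, -, r, hr, -, -, hY, hs, ht⟩ := h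
  refine ⟨hst, q, r, ((eball_subset q hr).trans (by rw [hq])).trans hY,
    ⟨(q.1, q.2 - r / 2), ?_, hs ⟨Metric.mem_ball_self hr, ?_⟩⟩,
    ⟨(q.1, q.2 + r / 2), ?_, ht ⟨Metric.mem_ball_self hr, ?_⟩⟩⟩
  · simp only [eball, mem_ofPred_eq, sub_self, norm_zero]; nlinarith
  · rw [hq]; constructor <;> simp only <;> linarith
  · simp only [eball, mem_ofPred_eq, sub_self, norm_zero]; nlinarith
  · rw [hq]; constructor <;> simp only <;> linarith

theorem exists_junction (hY : IsOpen Y) {q : Pt N} (hq : q ∈ Y) {i : Fin D.M}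
    (hqi : q.2 = D.a i.succ) : ∃ s t : D.Idx, s.1 = i ∧ D.Joins s t ∧ D.Junction s t q := by
  -- `Y` lies strictly below the top height, so there is a slab above `q`.
  have hlt : D.a i.succ < D.a (Fin.last D.M) := hqi ▸ D.height_lt q hq
  have hi : (i : ℕ) + 1 < D.M := by
    have := D.a_strictMono.lt_iff_lt.1 hlt
    simpa [Fin.lt_def] using this
  let i' : Fin D.M := ⟨i + 1, hi⟩
  have hi' : i'.castSucc = i.succ := Fin.ext (by simp [i'])
  have h1 := D.a_strictMono i.castSucc_lt_succ
  have h2 := D.a_strictMono i'.castSucc_lt_succ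
  rw [hi'] at h2
  obtain ⟨r, hr, hrδ, hrC⟩ := exists_box (hY.mem_nhds hq)
    (δ := min (D.a i.succ - D.a i.castSucc) (D.a i'.succ - D.a i.succ))
    (lt_min (by linarith) (by linarith))
  have h3 := hrδ.trans (min_le_left _ _)
  have h4 := hrδ.trans (min_le_right _ _)
  -- The pieces containing the points at distance `r / 2` below and above `q` are the two joined at
  -- `q`.
  have m1 : (q.1, q.2 - r / 2) ∈ Metric.ball q.1 r ×ˢ Ioo (q.2 - r) (q.2 + r) :=
    ⟨Metric.mem_ball_self hr, by constructor <;> simp only <;> linarith⟩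
  have m2 : (q.1, q.2 + r / 2) ∈ Metric.ball q.1 r ×ˢ Ioo (q.2 - r) (q.2 + r) :=
    ⟨Metric.mem_ball_self hr, by constructor <;> simp only <;> linarith⟩
  obtain ⟨s, hs, hsm⟩ := D.exists_mem_piece i (hrC m1) (by constructor <;> simp only <;> linarith)
  obtain ⟨t, ht, htm⟩ := D.exists_mem_piece i' (hrC m2)
    (by rw [hi']; constructor <;> simp only <;> linarith)
  have hst : (t.1 : ℕ) = (s.1 : ℕ) + 1 := by rw [hs, ht]
  have hJ : D.Junction s t q := D.junction_of_convex hst (by rw [hqi, NiceDecomposition.hi, hs])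
    ((convex_ball q.1 r).prod (convex_Ioo _ _))
    ((Metric.isOpen_ball.prod isOpen_Ioo).mem_nhds
      ⟨Metric.mem_ball_self hr, by constructor <;> linarith⟩) hrC ⟨_, m1, hsm⟩ ⟨_, m2, htm⟩
  exact ⟨s, t, hs, hJ.joins D hst, hJ⟩

/-- The piece below a junction is determined by its slab. -/
theorem Junction.eq_of_mem_closure {s s' t : D.Idx} {q : Pt N} (h : D.Junction s t q)
    (hs : s'.1 = s.1) (hq : q ∈ closure (D.piece s')) : s' = s := by
  obtain ⟨hq2, -, r, hr, -, -, hY, hs1, ht1⟩ := h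
  -- The junction box is a neighbourhood of `q`, so it meets `s'`, necessarily below the interface,
  -- where the box lies in `s`.
  obtain ⟨z, hz, hzs⟩ := mem_closure_iff.1 hq
    (Metric.ball q.1 r ×ˢ Ioo (D.hi s - r) (D.hi s + r)) (Metric.isOpen_ball.prod isOpen_Ioo)
    ⟨Metric.mem_ball_self hr, by rw [hq2]; constructor <;> linarith⟩
  have hz2 := (D.mem_Ioo_of_mem_piece hzs).2
  have hhi : D.hi s' = D.hi s := by rw [hi, hi, hs]
  exact D.eq_of_mem_piece hzs (hs1 ⟨hz.1, hz.2.1, hhi ▸ hz2⟩)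

theorem Junction.mem_closure {s t : D.Idx} {q : Pt N} (h : D.Junction s t q) :
    q ∈ closure (D.piece s) := by
  obtain ⟨hq2, -, r, hr, -, -, hY, hs1, ht1⟩ := h
  refine closure_mono hs1 ?_
  rw [closure_prod_eq, closure_Ioo (by linarith)]
  exact ⟨subset_closure (Metric.mem_ball_self hr), by rw [hq2]; constructor <;> linarith⟩

/-! ### Measure of the pieces -/

/-- The points missed by the pieces lie in finitely many horizontal hyperplanes. -/
theorem volume_diff_pieces (hY : ∀ q ∈ Y, 0 < q.2) :
    volume (Y \ ⋃ s, D.piece s) = 0 := by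
  refine measure_mono_null (t := ⋃ k, (univ : Set (Hor N)) ×ˢ {D.a k}) ?_ ?_
  · rintro q ⟨hq, hqn⟩
    obtain ⟨i, hi⟩ := D.exists_height hY hq
    rcases hi.2.lt_or_eq with h | h
    · obtain ⟨s, -, hs⟩ := D.exists_mem_piece i hq ⟨hi.1, h⟩
      exact absurd (mem_iUnion.2 ⟨s, hs⟩) hqn
    · exact mem_iUnion.2 ⟨i.succ, mem_univ _, h⟩
  · rw [measure_iUnion_null_iff]
    intro k
    rw [Measure.volume_eq_prod, Measure.prod_prod]
    simp

theorem restrict_iUnion_pieces (hY : ∀ q ∈ Y, 0 < q.2) :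
    (volume : Measure (Pt N)).restrict (⋃ s, D.piece s) = volume.restrict Y := by
  refine Measure.restrict_congr_set (ae_eq_set.2 ⟨?_, D.volume_diff_pieces hY⟩)
  rw [sdiff_eq_empty.2 (iUnion_subset fun s => D.piece_subset s), measure_empty]

theorem ae_restrict_of_pieces (hY : ∀ q ∈ Y, 0 < q.2) {P : Pt N → Prop}
    (h : ∀ s, ∀ᵐ q ∂(volume.restrict (D.piece s)), P q) : ∀ᵐ q ∂(volume.restrict Y), P q := by
  rw [← D.restrict_iUnion_pieces hY, ae_restrict_iUnion_iff]
  exact h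

theorem pairwise_disjoint_pieces : Pairwise (Function.onFun Disjoint D.piece) := by
  intro s t hst
  exact disjoint_left.2 fun q hs ht => hst (D.eq_of_mem_piece hs ht)

theorem setIntegral_eq_sum_pieces (hYo : IsOpen Y) (hY : ∀ q ∈ Y, 0 < q.2) {F : Pt N → ℝ}
    (hF : IntegrableOn F Y) : ∫ q in Y, F q = ∑ s, ∫ q in D.piece s, F q := by
  rw [← D.restrict_iUnion_pieces hY]
  exact integral_iUnion_fintype (fun s => (D.piece_isOpen hYo s).measurableSet)
    D.pairwise_disjoint_pieces fun s => hF.mono_set (D.piece_subset s)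

/-- Cavalieri's principle: by Fubini the measure of the part of a piece over `A` is the integral
over `A` of the section measures. Boundedness of `Y` makes these finite, so the real-valued
thickness loses nothing. -/
theorem map_snd_restrict_piece (hY : IsOpen Y) (hb : Bornology.IsBounded Y) (s : D.Idx) :
    Measure.map Prod.snd ((volume : Measure (Pt N)).restrict (D.piece s))
      = wMeasure (D.lo s) (D.hi s) (D.p s) := by
  have hm := (D.piece_isOpen hY s).measurableSet
  ext A hA
  rw [Measure.map_apply measurable_snd hA, Measure.restrict_apply (measurable_snd hA),
    wMeasure, withDensity_apply _ hA, Measure.restrict_restrict hA, Measure.volume_eq_prod,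
    Measure.prod_apply_symm ((measurable_snd hA).inter hm),
    ← lintegral_indicator (hA.inter measurableSet_Ioo)]
  refine lintegral_congr fun y => ?_
  by_cases hy : y ∈ A ∩ Ioo (D.lo s) (D.hi s)
  · rw [indicator_of_mem hy]
    have e : (fun x : Hor N => (x, y)) ⁻¹' (Prod.snd ⁻¹' A ∩ D.piece s) = {ξ | (ξ, y) ∈ D.piece s} := by
      ext ξ; simp [hy.1]
    have hbd : Bornology.IsBounded {ξ : Hor N | (ξ, y) ∈ D.piece s} :=
      (hb.image_fst).subset fun ξ hξ => ⟨(ξ, y), D.piece_subset s hξ, rfl⟩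
    rw [e, p, closedThickness, if_pos hy.2, thickness, ofReal_measureReal hbd.measure_lt_top.ne]
  · rw [indicator_of_notMem hy]
    convert measure_empty (μ := (volume : Measure (Hor N)))
    ext ξ
    simp only [mem_preimage, mem_inter_iff, mem_empty_iff_false, iff_false]
    exact fun h => hy ⟨h.1, D.mem_Ioo_of_mem_piece h.2⟩

end NiceDecomposition

/-! ### Functions on the pieces depending on the height only -/

namespace NiceDecomposition

variable {N : ℕ} {Y : Set (Pt N)} (D : NiceDecomposition Y)

theorem wMeasure_absolutelyContinuous {a b : ℝ} {p : ℝ → ℝ} : wMeasure a b p ≪ volume.restrict (Ioo a b) :=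
  withDensity_absolutelyContinuous _ _

theorem measurePreserving_snd (hY : IsOpen Y) (hb : Bornology.IsBounded Y) (s : D.Idx) :
    MeasurePreserving Prod.snd ((volume : Measure (Pt N)).restrict (D.piece s))
      (wMeasure (D.lo s) (D.hi s) (D.p s)) :=
  ⟨measurable_snd, D.map_snd_restrict_piece hY hb s⟩

theorem ae_piece_of_ae (hY : IsOpen Y) (hb : Bornology.IsBounded Y) {s : D.Idx} {P : ℝ → Prop}
    (h : ∀ᵐ y ∂(wMeasure (D.lo s) (D.hi s) (D.p s)), P y) :
    ∀ᵐ q ∂((volume : Measure (Pt N)).restrict (D.piece s)), P q.2 :=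
  (D.measurePreserving_snd hY hb s).quasiMeasurePreserving.ae h

/-- A section of positive thickness is nonempty, so the piece projects onto its whole interval of
heights. -/
theorem exists_mem_piece_of_mem_Ioo {s : D.Idx} {y : ℝ} (hy : y ∈ Ioo (D.lo s) (D.hi s)) :
    ∃ ξ, (ξ, y) ∈ D.piece s := by
  by_contra! hcon
  have h := (D.isWeight s).pos y (Ioo_subset_Icc_self hy)
  rw [p, closedThickness, if_pos hy, thickness] at h
  simp [hcon] at h

/-- A square integrable function on a piece whose weak horizontal derivatives vanish depends on the
height only. -/
theorem exists_ae_eq_comp_snd (hY : IsOpen Y) (hb : Bornology.IsBounded Y) (s : D.Idx)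
    {u : Pt N → ℝ} (hu : MemLp u 2 (volume.restrict (D.piece s)))
    (h : ∀ v : Hor N, HasWeakDirDeriv volume (D.piece s) (v, 0) u 0) :
    ∃ f : Lp ℝ 2 (wMeasure (D.lo s) (D.hi s) (D.p s)),
      ∀ᵐ q ∂(volume.restrict (D.piece s)), u q = f q.2 := by
  classical
  have hso := D.piece_isOpen hY s
  have : IsFiniteMeasure ((volume : Measure (Pt N)).restrict (D.piece s)) :=
    ⟨by simpa using (hb.subset (D.piece_subset s)).measure_lt_top⟩
  have hui : IntegrableOn u (D.piece s) := hu.integrable (by norm_num)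
  have : (volume : Measure (Pt N)).IsAddHaarMeasure :=
    inferInstanceAs ((volume : Measure (Hor N)).prod (volume : Measure ℝ)).IsAddHaarMeasure
  obtain ⟨U, hU, hloc⟩ := exists_locally_const_of_hasWeakDirDeriv_zero hso hui
    (V := {w : Pt N | w.2 = 0}) (by rintro ⟨v, y⟩ (rfl : y = 0); exact h v)
  -- Horizontal local constancy propagates along the connected section.
  have hconst : ∀ q ∈ D.piece s, ∀ q' ∈ D.piece s, q.2 = q'.2 → U q = U q' := by
    intro q hq q' hq' hqq
    refine (D.connectedSections s.1 s.2 q.2).induction₂ (fun x z => U x = U z) (fun x hx => ?_)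
      (fun _ _ _ _ _ _ => Eq.trans) (fun _ _ _ _ => Eq.symm) ⟨hq, rfl⟩ ⟨hq', hqq.symm⟩
    obtain ⟨r, hr, hrU⟩ := hloc x hx.1
    filter_upwards [mem_nhdsWithin_of_mem_nhds (Metric.ball_mem_nhds x hr), self_mem_nhdsWithin]
      with z hz hz2
    have := hrU x (Metric.mem_ball_self hr) (z - x)
      (by change z.2 - x.2 = 0; rw [hz2.2, hx.2, sub_self]) (by simpa using hz)
    simpa using this.symm
  let f : ℝ → ℝ := fun y => if hy : ∃ ξ, (ξ, y) ∈ D.piece s then U (hy.choose, y) else 0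
  have hf : ∀ q ∈ D.piece s, U q = f q.2 := by
    intro q hq
    have hy : ∃ ξ, (ξ, q.2) ∈ D.piece s := ⟨q.1, hq⟩
    simp only [f, dif_pos hy]
    exact hconst q hq _ hy.choose_spec rfl
  have hfu : ∀ᵐ q ∂(volume.restrict (D.piece s)), u q = f q.2 := by
    filter_upwards [hU, ae_restrict_mem hso.measurableSet] with q hq hqs
    rw [← hq, hf q hqs]
  -- `f` is defined by choice, so measurability needs an argument: on a box inside the piece `f q.2`
  -- is integrable, and Fubini makes `f` integrable on the interval since the ball has positive
  -- measure.
  have hfm : AEStronglyMeasurable f (volume.restrict (Ioo (D.lo s) (D.hi s))) := by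
    apply LocallyIntegrableOn.aestronglyMeasurable
    intro y hy
    obtain ⟨ξ, hξ⟩ := D.exists_mem_piece_of_mem_Ioo hy
    obtain ⟨r, hr, -, hrs⟩ := exists_box (hso.mem_nhds hξ) one_pos
    refine ⟨Ioo (y - r) (y + r), mem_nhdsWithin_of_mem_nhds (Ioo_mem_nhds (by linarith)
      (by linarith)), ?_⟩
    have hfi : IntegrableOn (fun q : Pt N => f q.2) (D.piece s) := hui.congr_fun_ae hfu
    have hi : IntegrableOn (fun q : Pt N => f q.2) (Metric.ball ξ r ×ˢ Ioo (y - r) (y + r)) :=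
      hfi.mono_set hrs
    rw [IntegrableOn, Measure.volume_eq_prod, ← Measure.prod_restrict] at hi
    refine hi.of_comp_snd ?_
    rw [Ne, Measure.restrict_eq_zero]
    exact (Metric.measure_ball_pos volume ξ hr).ne'
  have hfm' := hfm.mono_ac (wMeasure_absolutelyContinuous (p := D.p s))
  have hfL : MemLp f 2 (wMeasure (D.lo s) (D.hi s) (D.p s)) := by
    rw [← D.map_snd_restrict_piece hY hb s] at hfm' ⊢
    rw [memLp_map_measure_iff hfm' measurable_snd.aemeasurable]
    exact (memLp_congr_ae hfu).1 hu
  refine ⟨hfL.toLp f, ?_⟩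
  filter_upwards [hfu, D.ae_piece_of_ae hY hb hfL.coeFn_toLp] with q h1 h2
  rw [h1, h2]

/-- The function equal to `f₁` below `h` and to `f₂` from `h` on. -/
def stepAt (h : ℝ) (f₁ f₂ : ℝ → ℝ) (y : ℝ) : ℝ := open Classical in if y < h then f₁ y else f₂ y

theorem stepAt_eqOn_left (h : ℝ) (f₁ f₂ : ℝ → ℝ) (a : ℝ) : EqOn (stepAt h f₁ f₂) f₁ (Ioo a h) :=
  fun _ hy => if_pos hy.2

theorem stepAt_eqOn_right (h : ℝ) (f₁ f₂ : ℝ → ℝ) (b : ℝ) : EqOn (stepAt h f₁ f₂) f₂ (Ioo h b) :=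
  fun _ hy => if_neg hy.1.not_gt

theorem integrableOn_stepAt {a b h : ℝ} {f₁ f₂ : ℝ → ℝ} (h1 : IntegrableOn f₁ (Ioo a h))
    (h2 : IntegrableOn f₂ (Ioo h b)) : IntegrableOn (stepAt h f₁ f₂) (Ioo a b) := by
  have e1 := h1.congr_fun (stepAt_eqOn_left h f₁ f₂ a).symm measurableSet_Ioo
  have e2 := h2.congr_fun (stepAt_eqOn_right h f₁ f₂ b).symm measurableSet_Ioo
  have e3 : IntegrableOn (stepAt h f₁ f₂) {h} := integrableOn_singleton (hx := by simp)
  refine ((e1.union e2).union e3).mono_set fun y hy => ?_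
  rcases lt_trichotomy y h with hh | hh | hh
  · exact Or.inl (Or.inl ⟨hy.1, hh⟩)
  · exact Or.inr hh
  · exact Or.inl (Or.inr ⟨hh, hy.2⟩)

/-- The interface between the two halves of the box is a null set. -/
theorem ae_box_eq_stepAt {s t : D.Idx} {ξ : Hor N} {r : ℝ} {u : Pt N → ℝ} {f₁ f₂ : ℝ → ℝ}
    (hs : Metric.ball ξ r ×ˢ Ioo (D.hi s - r) (D.hi s) ⊆ D.piece s)
    (ht : Metric.ball ξ r ×ˢ Ioo (D.hi s) (D.hi s + r) ⊆ D.piece t)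
    (h1 : ∀ᵐ q ∂(volume.restrict (D.piece s)), u q = f₁ q.2)
    (h2 : ∀ᵐ q ∂(volume.restrict (D.piece t)), u q = f₂ q.2) :
    ∀ᵐ q ∂(volume.restrict (Metric.ball ξ r ×ˢ Ioo (D.hi s - r) (D.hi s + r))),
      u q = stepAt (D.hi s) f₁ f₂ q.2 := by
  have h3 : ∀ᵐ q : Pt N, q.2 ≠ D.hi s := by
    rw [ae_iff]
    refine measure_mono_null (t := (univ : Set (Hor N)) ×ˢ {D.hi s}) (fun q hq => ?_) ?_
    · simpa using hq
    · rw [Measure.volume_eq_prod, Measure.prod_prod]; simp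
  have h1' := ae_restrict_of_ae_restrict_of_subset hs h1
  have h2' := ae_restrict_of_ae_restrict_of_subset ht h2
  rw [ae_restrict_iff' (measurableSet_ball.prod measurableSet_Ioo)] at h1' h2' ⊢
  filter_upwards [h1', h2', h3] with q e1 e2 e3 hq
  rcases lt_or_gt_of_ne e3 with h | h
  · rw [stepAt, if_pos h, e1 ⟨hq.1, hq.2.1, h⟩]
  · rw [stepAt, if_neg h.not_gt, e2 ⟨hq.1, h, hq.2.2⟩]

/-! ### Elements of the weighted spaces and their continuous representatives. -/

theorem integrableOn_wfn {a b : ℝ} {p : ℝ → ℝ} {hp : IsWeight a b p} (φ : WH1 a b p hp) :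
    IntegrableOn (wfn φ) (Ioo a b) :=
  (hp.memLp (φ : WAmbient a b p).fst).integrable (by norm_num)

theorem integrableOn_wder {a b : ℝ} {p : ℝ → ℝ} {hp : IsWeight a b p} (φ : WH1 a b p hp) :
    IntegrableOn (wder φ) (Ioo a b) :=
  (hp.memLp (φ : WAmbient a b p).snd).integrable (by norm_num)

theorem hasWeakDirDeriv_wfn {a b : ℝ} {p : ℝ → ℝ} {hp : IsWeight a b p} (φ : WH1 a b p hp) :
    HasWeakDirDeriv volume (Ioo a b) 1 (wfn φ) (wder φ) :=
  hasWeakDeriv_iff.1 φ.2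

theorem exists_isContRepOf {a b : ℝ} {p : ℝ → ℝ} {hp : IsWeight a b p} (φ : WH1 a b p hp) :
    ∃ F, IsContRepOf φ F := by
  have hg : Integrable ((Ioo a b).indicator (wder φ)) :=
    (integrable_indicator_iff measurableSet_Ioo).2 (integrableOn_wder φ)
  obtain ⟨c, hc⟩ := exists_ae_eq_primitive (integrableOn_wfn φ) hg
    ((hasWeakDirDeriv_wfn φ).congr ae_eq_rfl (indicator_ae_eq_restrict measurableSet_Ioo).symm) a
  refine ⟨fun y => c + ∫ t in a..y, (Ioo a b).indicator (wder φ) t,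
    (continuous_const.add (intervalIntegral.continuous_primitive
    (fun _ _ => hg.intervalIntegrable) a)).continuousOn, ?_⟩
  filter_upwards [hc] with y hy using hy.symm

/-- `u`, with vertical derivative `g`, is on each piece the function of the height given by `φ`. -/
def Represents (φ : PiLp 2 D.EdgeH1) (u g : Pt N → ℝ) : Prop :=
  ∀ s, ∀ᵐ q ∂(volume.restrict (D.piece s)), u q = wfn (φ s) q.2 ∧ g q = wder (φ s) q.2

variable {D}

/-- On a junction box the function depends on the height alone, so its weak differentiability
descends to an interval around the interface; one-variable continuity does the rest. -/
theorem Represents.continuityConditions {φ : PiLp 2 D.EdgeH1} {u g : Pt N → ℝ}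
    (h : D.Represents φ u g) (hug : HasWeakDirDeriv volume Y (0, 1) u g) {F : D.Idx → ℝ → ℝ}
    (hF : D.IsContRep φ F) : D.ContinuityConditions F := by
  intro s t hst
  obtain ⟨q, -, hlt, r, hr, hrs, hrt, hYr, hs, ht⟩ := Joins.exists_junction D hst
  have hu := D.ae_box_eq_stepAt hs ht ((h s).mono fun _ => And.left)
    ((h t).mono fun _ => And.left)
  have hg := D.ae_box_eq_stepAt hs ht ((h s).mono fun _ => And.right)
    ((h t).mono fun _ => And.right)
  have hW := ((hug.mono hYr).congr hu hg).of_box_vert Metric.isOpen_ball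
    ⟨q.1, Metric.mem_ball_self hr⟩
  have s1 : Ioo (D.hi s - r) (D.hi s) ⊆ Ioo (D.lo s) (D.hi s) := Ioo_subset_Ioo_left hrs
  have s2 : Ioo (D.hi s) (D.hi s + r) ⊆ Ioo (D.lo t) (D.hi t) := by
    rw [hlt]; exact Ioo_subset_Ioo_right hrt
  refine hW.eq_of_continuousOn (by linarith) (by linarith)
    (integrableOn_stepAt ((integrableOn_wfn (φ s)).mono_set s1)
      ((integrableOn_wfn (φ t)).mono_set s2))
    (integrableOn_stepAt ((integrableOn_wder (φ s)).mono_set s1)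
      ((integrableOn_wder (φ t)).mono_set s2))
    ((hF s).1.mono (Icc_subset_Icc_left hrs))
    ((hF t).1.mono (by rw [hlt]; exact Icc_subset_Icc_right hrt)) ?_ ?_
  · filter_upwards [ae_restrict_of_ae_restrict_of_subset s1 (hF s).2,
      ae_restrict_mem measurableSet_Ioo] with y h1 h2
    rw [h1, stepAt_eqOn_left _ _ _ _ h2]
  · filter_upwards [ae_restrict_of_ae_restrict_of_subset s2 (hF t).2,
      ae_restrict_mem measurableSet_Ioo] with y h1 h2
    rw [h1, stepAt_eqOn_right _ _ _ _ h2]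

/-- Near each point of `Y`, a function represented by an element of the graph space is a weakly
differentiable function of the height. -/
theorem Represents.exists_box (hY : IsOpen Y) (hpos : ∀ q ∈ Y, 0 < q.2) {φ : PiLp 2 D.EdgeH1}
    (hφ : φ ∈ D.graphSpace) {u g : Pt N → ℝ} (h : D.Represents φ u g) {q : Pt N} (hq : q ∈ Y) :
    ∃ (r a b : ℝ) (f f' : ℝ → ℝ), 0 < r ∧ q.2 ∈ Ioo a b ∧ IntegrableOn f (Ioo a b) ∧
      IntegrableOn f' (Ioo a b) ∧ HasWeakDirDeriv volume (Ioo a b) 1 f f' ∧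
      (∀ᵐ z ∂(volume.restrict (Metric.ball q.1 r ×ˢ Ioo a b)), f z.2 = u z) ∧
      ∀ᵐ z ∂(volume.restrict (Metric.ball q.1 r ×ˢ Ioo a b)), f' z.2 = g z := by
  obtain ⟨i, hi⟩ := D.exists_height hpos hq
  rcases hi.2.lt_or_eq with hlt | heq
  · obtain ⟨s, rfl, hs⟩ := D.exists_mem_piece i hq ⟨hi.1, hlt⟩
    obtain ⟨r, hr, -, hrs⟩ := NiceDecomposition.exists_box
      ((D.piece_isOpen hY s).mem_nhds hs) one_pos
    have hsub : Ioo (q.2 - r) (q.2 + r) ⊆ Ioo (D.lo s) (D.hi s) := fun y hy =>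
      D.mem_Ioo_of_mem_piece (hrs (show (q.1, y) ∈ _ from ⟨Metric.mem_ball_self hr, hy⟩))
    refine ⟨r, q.2 - r, q.2 + r, wfn (φ s), wder (φ s), hr, by constructor <;> linarith,
      (integrableOn_wfn _).mono_set hsub, (integrableOn_wder _).mono_set hsub,
      (hasWeakDirDeriv_wfn _).mono hsub, ?_, ?_⟩
    · exact ae_restrict_of_ae_restrict_of_subset hrs ((h s).mono fun _ hz => hz.1.symm)
    · exact ae_restrict_of_ae_restrict_of_subset hrs ((h s).mono fun _ hz => hz.2.symm)
  · obtain ⟨s, t, -, hst, hq2, hlt, r, hr, hrs, hrt, hYr, hs, ht⟩ := D.exists_junction hY hq heq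
    obtain ⟨F, hF, hFc⟩ := hφ
    have hu := D.ae_box_eq_stepAt hs ht ((h s).mono fun _ => And.left)
      ((h t).mono fun _ => And.left)
    have hg := D.ae_box_eq_stepAt hs ht ((h s).mono fun _ => And.right)
      ((h t).mono fun _ => And.right)
    have s1 : Ioo (D.hi s - r) (D.hi s) ⊆ Ioo (D.lo s) (D.hi s) := Ioo_subset_Ioo_left hrs
    have s2 : Ioo (D.hi s) (D.hi s + r) ⊆ Ioo (D.lo t) (D.hi t) := by
      rw [hlt]; exact Ioo_subset_Ioo_right hrt
    have i1 := integrableOn_stepAt ((integrableOn_wfn (φ s)).mono_set s1)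
      ((integrableOn_wfn (φ t)).mono_set s2)
    have i2 := integrableOn_stepAt ((integrableOn_wder (φ s)).mono_set s1)
      ((integrableOn_wder (φ t)).mono_set s2)
    refine ⟨r, D.hi s - r, D.hi s + r, stepAt (D.hi s) (wfn (φ s)) (wfn (φ t)),
      stepAt (D.hi s) (wder (φ s)) (wder (φ t)), hr, by rw [hq2]; constructor <;> linarith,
      i1, i2, ?_, hu.mono fun _ => Eq.symm, hg.mono fun _ => Eq.symm⟩
    -- On the interface the continuity condition `hFc` is exactly the matching of end values needed
    -- to glue.
    refine HasWeakDirDeriv.glue (h := D.hi s) (F₁ := F s) (F₂ := F t) (by linarith) (by linarith)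
      i1 i2 ?_ ?_ ((hF s).1.mono (Icc_subset_Icc_left hrs))
      ((hF t).1.mono (by rw [hlt]; exact Icc_subset_Icc_right hrt)) ?_ ?_ (hFc s t hst)
    · refine ((hasWeakDirDeriv_wfn (φ s)).mono s1).congr ?_ ?_
      · exact (ae_restrict_mem measurableSet_Ioo).mono fun y hy =>
          (stepAt_eqOn_left _ _ _ _ hy).symm
      · exact (ae_restrict_mem measurableSet_Ioo).mono fun y hy =>
          (stepAt_eqOn_left _ _ _ _ hy).symm
    · refine ((hasWeakDirDeriv_wfn (φ t)).mono s2).congr ?_ ?_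
      · exact (ae_restrict_mem measurableSet_Ioo).mono fun y hy =>
          (stepAt_eqOn_right _ _ _ _ hy).symm
      · exact (ae_restrict_mem measurableSet_Ioo).mono fun y hy =>
          (stepAt_eqOn_right _ _ _ _ hy).symm
    · filter_upwards [ae_restrict_of_ae_restrict_of_subset s1 (hF s).2,
        ae_restrict_mem measurableSet_Ioo] with y h1 h2
      rw [h1, stepAt_eqOn_left _ _ _ _ h2]
    · filter_upwards [ae_restrict_of_ae_restrict_of_subset s2 (hF t).2,
        ae_restrict_mem measurableSet_Ioo] with y h1 h2
      rw [h1, stepAt_eqOn_right _ _ _ _ h2]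

theorem Represents.hasWeakDirDeriv_vert (hY : IsOpen Y) (hpos : ∀ q ∈ Y, 0 < q.2)
    {φ : PiLp 2 D.EdgeH1} (hφ : φ ∈ D.graphSpace) {u g : Pt N → ℝ} (h : D.Represents φ u g)
    (hu : IntegrableOn u Y) (hg : IntegrableOn g Y) : HasWeakDirDeriv volume Y (0, 1) u g := by
  refine HasWeakDirDeriv.of_locally hu hg fun q hq => ?_
  obtain ⟨r, a, b, f, f', hr, hqab, hf, hf', hff', hfu, hfg⟩ := h.exists_box hY hpos hφ hq
  exact ⟨_, Metric.isOpen_ball.prod isOpen_Ioo, ⟨Metric.mem_ball_self hr, hqab⟩,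
    (hff'.box_vert measure_ball_lt_top.ne hf hf').congr hfu hfg⟩

theorem Represents.hasWeakDirDeriv_hor (hY : IsOpen Y) (hpos : ∀ q ∈ Y, 0 < q.2)
    {φ : PiLp 2 D.EdgeH1} (hφ : φ ∈ D.graphSpace) {u g : Pt N → ℝ} (h : D.Represents φ u g)
    (hu : IntegrableOn u Y) (v : Hor N) : HasWeakDirDeriv volume Y (v, 0) u 0 := by
  refine HasWeakDirDeriv.of_locally hu integrableOn_zero fun q hq => ?_
  obtain ⟨r, a, b, f, f', hr, hqab, hf, hf', hff', hfu, hfg⟩ := h.exists_box hY hpos hφ hq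
  exact ⟨_, Metric.isOpen_ball.prod isOpen_Ioo, ⟨Metric.mem_ball_self hr, hqab⟩,
    (hasWeakDirDeriv_box_hor measure_ball_lt_top.ne hf v).congr hfu ae_eq_rfl⟩

end NiceDecomposition

/-! ### Norms -/

theorem norm_sq_eq_integral {α : Type*} [MeasurableSpace α] {μ : Measure α} (f : Lp ℝ 2 μ) :
    ‖f‖ ^ 2 = ∫ x, f x ^ 2 ∂μ := by
  rw [← real_inner_self_eq_norm_sq, L2.inner_def]
  refine integral_congr_ae (Eventually.of_forall fun x => ?_)
  simp [sq]

theorem integrable_sq_Lp {α : Type*} [MeasurableSpace α] {μ : Measure α} (f : Lp ℝ 2 μ) :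
    Integrable (fun x => f x ^ 2) μ := (Lp.memLp f).integrable_sq

theorem norm_sq_H1Xi {N : ℕ} {S : Set (Pt N)} (u : H1Xi S) :
    ‖u‖ ^ 2 = ∫ q in S, (fn u q ^ 2 + dy u q ^ 2) := by
  have h0 : ((u : H1 S) : H1Ambient S).snd.fst = 0 := u.2
  have h1 : ‖u‖ ^ 2 = ‖((u : H1 S) : H1Ambient S)‖ ^ 2 := rfl
  rw [h1, WithLp.prod_norm_sq_eq_of_L2, WithLp.prod_norm_sq_eq_of_L2, h0, norm_zero,
    norm_sq_eq_integral, norm_sq_eq_integral]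
  simp only [ne_eq, OfNat.ofNat_ne_zero, not_false_eq_true, zero_pow, zero_add]
  exact (integral_add (integrable_sq_Lp _) (integrable_sq_Lp _)).symm

theorem norm_sq_WH1 {a b : ℝ} {p : ℝ → ℝ} {hp : IsWeight a b p} (φ : WH1 a b p hp) :
    ‖φ‖ ^ 2 = ∫ y, (wfn φ y ^ 2 + wder φ y ^ 2) ∂(wMeasure a b p) := by
  have h1 : ‖φ‖ ^ 2 = ‖(φ : WAmbient a b p)‖ ^ 2 := rfl
  rw [h1, WithLp.prod_norm_sq_eq_of_L2, norm_sq_eq_integral, norm_sq_eq_integral]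
  exact (integral_add (integrable_sq_Lp _) (integrable_sq_Lp _)).symm

theorem IsWeight.integral_wMeasure {a b : ℝ} {p : ℝ → ℝ} (hp : IsWeight a b p) (f : ℝ → ℝ) :
    ∫ y, f y ∂(wMeasure a b p) = ∫ y in Ioo a b, p y * f y := by
  have hm : AEMeasurable p (volume.restrict (Ioo a b)) :=
    (hp.cont.mono Ioo_subset_Icc_self).aemeasurable measurableSet_Ioo
  rw [wMeasure, integral_withDensity_eq_integral_toReal_smul₀ hm.ennreal_ofReal
    (Eventually.of_forall fun _ => ENNReal.ofReal_lt_top)]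
  refine setIntegral_congr_fun measurableSet_Ioo fun y hy => ?_
  simp [ENNReal.toReal_ofReal (hp.pos y (Ioo_subset_Icc_self hy)).le]

namespace NiceDecomposition

variable {N : ℕ} {Y : Set (Pt N)} {D : NiceDecomposition Y}

theorem norm_sq_graphSpace (φ : D.graphSpace) :
    ‖φ‖ ^ 2 = ∑ s, ∫ y, (wfn (D.edge φ s) y ^ 2 + wder (D.edge φ s) y ^ 2)
      ∂(wMeasure (D.lo s) (D.hi s) (D.p s)) := by
  have h1 : ‖φ‖ ^ 2 = ‖(φ : PiLp 2 D.EdgeH1)‖ ^ 2 := rfl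
  rw [h1, PiLp.norm_sq_eq_of_L2]
  exact Finset.sum_congr rfl fun s _ => norm_sq_WH1 _

theorem norm_sq_H1Xi_eq_sum (hY : IsOpen Y) (hpos : ∀ q ∈ Y, 0 < q.2) (u : H1Xi Y) :
    ‖u‖ ^ 2 = ∑ s : D.Idx, ∫ q in D.piece s, (fn u q ^ 2 + dy u q ^ 2) := by
  rw [norm_sq_H1Xi]
  exact D.setIntegral_eq_sum_pieces hY hpos ((integrable_sq_Lp _).add (integrable_sq_Lp _))

/-- Change of variables under the projection to the height, piece by piece. -/
theorem Represents.norm_eq (hY : IsOpen Y) (hb : Bornology.IsBounded Y) (hpos : ∀ q ∈ Y, 0 < q.2)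
    {u : H1Xi Y} {φ : D.graphSpace} (h : D.Represents φ (fn u) (dy u)) : ‖φ‖ = ‖u‖ := by
  refine (pow_left_inj₀ (norm_nonneg _) (norm_nonneg _) two_ne_zero).1 ?_
  refine (norm_sq_graphSpace φ).trans (Eq.trans (Finset.sum_congr rfl fun s _ => ?_)
    (norm_sq_H1Xi_eq_sum (D := D) hY hpos u).symm)
  rw [← D.map_snd_restrict_piece hY hb s, integral_map measurable_snd.aemeasurable]
  · refine integral_congr_ae ?_
    filter_upwards [h s] with q hq
    rw [hq.1, hq.2]
    rfl
  · rw [D.map_snd_restrict_piece hY hb s]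
    exact ((integrable_sq_Lp _).add (integrable_sq_Lp _)).aestronglyMeasurable

theorem Represents.add (hY : IsOpen Y) (hb : Bornology.IsBounded Y) {u v : H1Xi Y}
    {φ ψ : D.graphSpace} (h : D.Represents φ (fn u) (dy u)) (k : D.Represents ψ (fn v) (dy v)) :
    D.Represents (φ + ψ : D.graphSpace) (fn (u + v)) (dy (u + v)) := by
  intro s
  have e1 : ∀ᵐ q ∂(volume.restrict Y), fn (u + v) q = fn u q + fn v q :=
    Lp.coeFn_add ((u : H1 Y) : H1Ambient Y).fst ((v : H1 Y) : H1Ambient Y).fst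
  have e2 : ∀ᵐ q ∂(volume.restrict Y), dy (u + v) q = dy u q + dy v q :=
    Lp.coeFn_add ((u : H1 Y) : H1Ambient Y).snd.snd ((v : H1 Y) : H1Ambient Y).snd.snd
  have e3 : ∀ᵐ y ∂(wMeasure (D.lo s) (D.hi s) (D.p s)),
      wfn (D.edge (φ + ψ) s) y = wfn (D.edge φ s) y + wfn (D.edge ψ s) y :=
    Lp.coeFn_add (D.edge φ s : WAmbient (D.lo s) (D.hi s) (D.p s)).fst
      (D.edge ψ s : WAmbient (D.lo s) (D.hi s) (D.p s)).fst
  have e4 : ∀ᵐ y ∂(wMeasure (D.lo s) (D.hi s) (D.p s)),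
      wder (D.edge (φ + ψ) s) y = wder (D.edge φ s) y + wder (D.edge ψ s) y :=
    Lp.coeFn_add (D.edge φ s : WAmbient (D.lo s) (D.hi s) (D.p s)).snd
      (D.edge ψ s : WAmbient (D.lo s) (D.hi s) (D.p s)).snd
  filter_upwards [ae_restrict_of_ae_restrict_of_subset (D.piece_subset s) e1,
    ae_restrict_of_ae_restrict_of_subset (D.piece_subset s) e2, D.ae_piece_of_ae hY hb e3,
    D.ae_piece_of_ae hY hb e4, h s, k s] with q h1 h2 h3 h4 h5 h6
  rw [h1, h2, h5.1, h5.2, h6.1, h6.2]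
  exact ⟨h3.symm, h4.symm⟩

theorem Represents.smul (hY : IsOpen Y) (hb : Bornology.IsBounded Y) (c : ℝ) {u : H1Xi Y}
    {φ : D.graphSpace} (h : D.Represents φ (fn u) (dy u)) :
    D.Represents (c • φ : D.graphSpace) (fn (c • u)) (dy (c • u)) := by
  intro s
  have e1 : ∀ᵐ q ∂(volume.restrict Y), fn (c • u) q = c * fn u q :=
    Lp.coeFn_smul c ((u : H1 Y) : H1Ambient Y).fst
  have e2 : ∀ᵐ q ∂(volume.restrict Y), dy (c • u) q = c * dy u q :=
    Lp.coeFn_smul c ((u : H1 Y) : H1Ambient Y).snd.snd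
  have e3 : ∀ᵐ y ∂(wMeasure (D.lo s) (D.hi s) (D.p s)),
      wfn (D.edge (c • φ) s) y = c * wfn (D.edge φ s) y :=
    Lp.coeFn_smul c (D.edge φ s : WAmbient (D.lo s) (D.hi s) (D.p s)).fst
  have e4 : ∀ᵐ y ∂(wMeasure (D.lo s) (D.hi s) (D.p s)),
      wder (D.edge (c • φ) s) y = c * wder (D.edge φ s) y :=
    Lp.coeFn_smul c (D.edge φ s : WAmbient (D.lo s) (D.hi s) (D.p s)).snd
  filter_upwards [ae_restrict_of_ae_restrict_of_subset (D.piece_subset s) e1,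
    ae_restrict_of_ae_restrict_of_subset (D.piece_subset s) e2, D.ae_piece_of_ae hY hb e3,
    D.ae_piece_of_ae hY hb e4, h s] with q h1 h2 h3 h4 h5
  rw [h1, h2, h5.1, h5.2]
  exact ⟨h3.symm, h4.symm⟩

/-- `φ - ψ` represents `u - u = 0`, so its norm is zero. -/
theorem Represents.eq (hY : IsOpen Y) (hb : Bornology.IsBounded Y) (hpos : ∀ q ∈ Y, 0 < q.2)
    {u : H1Xi Y} {φ ψ : D.graphSpace} (h : D.Represents φ (fn u) (dy u))
    (k : D.Represents ψ (fn u) (dy u)) : φ = ψ := by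
  have hR := (h.add hY hb (k.smul hY hb (-1))).norm_eq hY hb hpos
  have h0 : u + (-1 : ℝ) • u = 0 := by module
  have h1 : φ + (-1 : ℝ) • ψ = 0 := norm_eq_zero.1 (hR.trans ((congrArg norm h0).trans norm_zero))
  have h2 : φ - ψ = φ + (-1 : ℝ) • ψ := by module
  exact sub_eq_zero.1 (h2.trans h1)

/-! ### Existence of representations -/

/-- Both `u` and `∂u/∂y` descend to functions of the height; boxes inside the piece show that the
second is the weak derivative of the first. -/
theorem exists_represents (hY : IsOpen Y) (hb : Bornology.IsBounded Y) (u : H1Xi Y) :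
    ∃ φ : D.graphSpace, D.Represents φ (fn u) (dy u) := by
  have hW : HasWeakGrad Y (fn u) ((u : H1 Y) : H1Ambient Y).snd.fst (dy u) := (u : H1 Y).2
  have h0 : ((u : H1 Y) : H1Ambient Y).snd.fst = 0 := u.2
  have hver : HasWeakDirDeriv volume Y (0, 1) (fn u) (dy u) := hasWeakDirDeriv_iff.2 hW.ver
  have hhor : ∀ v : Hor N, HasWeakDirDeriv volume Y (v, 0) (fn u) 0 := fun v => by
    refine hasWeakDirDeriv_iff.2 fun η hη => ?_
    rw [hW.hor η hη v, h0]
    congr 1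
    refine integral_congr_ae ?_
    filter_upwards [Lp.coeFn_zero (Hor N) 2 (volume.restrict Y)] with q hq
    rw [hq]
    simp
  have hsub := D.piece_subset
  have m1 : ∀ s, MemLp (fn u) 2 (volume.restrict (D.piece s)) := fun s =>
    (Lp.memLp ((u : H1 Y) : H1Ambient Y).fst).mono_measure (Measure.restrict_mono_set _ (hsub s))
  have m2 : ∀ s, MemLp (dy u) 2 (volume.restrict (D.piece s)) := fun s =>
    (Lp.memLp ((u : H1 Y) : H1Ambient Y).snd.snd).mono_measure
      (Measure.restrict_mono_set _ (hsub s))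
  choose f hf using fun s => D.exists_ae_eq_comp_snd hY hb s (m1 s) fun v => (hhor v).mono (hsub s)
  choose g hg using fun s => D.exists_ae_eq_comp_snd hY hb s (m2 s) fun v =>
    ((hhor v).deriv_eq_zero hver).mono (hsub s)
  have hfg : ∀ s, HasWeakDeriv (D.lo s) (D.hi s) (f s) (g s) := by
    intro s
    rw [hasWeakDeriv_iff]
    refine HasWeakDirDeriv.of_locally (((D.isWeight s).memLp (f s)).integrable (by norm_num))
      (((D.isWeight s).memLp (g s)).integrable (by norm_num)) fun y hy => ?_
    obtain ⟨ξ, hξ⟩ := D.exists_mem_piece_of_mem_Ioo hy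
    obtain ⟨r, hr, -, hrs⟩ := NiceDecomposition.exists_box
      ((D.piece_isOpen hY s).mem_nhds hξ) one_pos
    refine ⟨Ioo (y - r) (y + r), isOpen_Ioo, by constructor <;> linarith, ?_⟩
    exact (((hver.mono (hrs.trans (hsub s))).congr
      (ae_restrict_of_ae_restrict_of_subset hrs (hf s))
      (ae_restrict_of_ae_restrict_of_subset hrs (hg s)))).of_box_vert Metric.isOpen_ball
        ⟨ξ, Metric.mem_ball_self hr⟩
  let φ : PiLp 2 D.EdgeH1 := WithLp.toLp 2 fun s => ⟨WithLp.toLp 2 (f s, g s), hfg s⟩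
  have hφ : D.Represents φ (fn u) (dy u) := fun s => (hf s).and (hg s)
  choose F hF using fun s => exists_isContRepOf (φ s)
  exact ⟨⟨φ, F, hF, hφ.continuityConditions hver hF⟩, hφ⟩

theorem exists_memLp_of_pieces (hY : IsOpen Y) (hb : Bornology.IsBounded Y)
    (f : ∀ s : D.Idx, Lp ℝ 2 (wMeasure (D.lo s) (D.hi s) (D.p s))) :
    ∃ u : Lp ℝ 2 ((volume : Measure (Pt N)).restrict Y),
      ∀ s, ∀ᵐ q ∂(volume.restrict (D.piece s)), u q = f s q.2 := by
  classical
  let w : Pt N → ℝ := fun q => ∑ s, (D.piece s).indicator (fun q => f s q.2) q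
  have hm : ∀ s, MeasurableSet (D.piece s) := fun s => (D.piece_isOpen hY s).measurableSet
  have hw : MemLp w 2 (volume.restrict Y) := by
    refine memLp_finsetSum _ fun s _ => ?_
    rw [memLp_indicator_iff_restrict (hm s), Measure.restrict_restrict (hm s),
      inter_eq_self_of_subset_left (D.piece_subset s)]
    exact (Lp.memLp (f s)).comp_measurePreserving (D.measurePreserving_snd hY hb s)
  refine ⟨hw.toLp w, fun s => ?_⟩
  filter_upwards [ae_restrict_of_ae_restrict_of_subset (D.piece_subset s) hw.coeFn_toLp,
    ae_restrict_mem (hm s)] with q h1 h2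
  rw [h1]
  simp only [w]
  -- The pieces are disjoint, so only one term of the sum survives.
  rw [Finset.sum_eq_single s, indicator_of_mem h2]
  · intro t _ hts
    exact indicator_of_notMem (fun ht => hts (D.eq_of_mem_piece ht h2)) _
  · simp

theorem exists_represented (hY : IsOpen Y) (hb : Bornology.IsBounded Y)
    (hpos : ∀ q ∈ Y, 0 < q.2) (φ : D.graphSpace) :
    ∃ u : H1Xi Y, D.Represents φ (fn u) (dy u) := by
  have : IsFiniteMeasure ((volume : Measure (Pt N)).restrict Y) :=
    ⟨by simpa using hb.measure_lt_top⟩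
  obtain ⟨u, hu⟩ := exists_memLp_of_pieces hY hb
    fun s => (D.edge φ s : WAmbient (D.lo s) (D.hi s) (D.p s)).fst
  obtain ⟨g, hg⟩ := exists_memLp_of_pieces hY hb
    fun s => (D.edge φ s : WAmbient (D.lo s) (D.hi s) (D.p s)).snd
  have hR : D.Represents φ u g := fun s => (hu s).and (hg s)
  have iu : IntegrableOn u Y := (Lp.memLp u).integrable (by norm_num)
  have ig : IntegrableOn g Y := (Lp.memLp g).integrable (by norm_num)
  have hgrad : HasWeakGrad Y u (0 : Lp (Hor N) 2 ((volume : Measure (Pt N)).restrict Y)) g := by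
    refine ⟨fun η hη v => ?_, hasWeakDirDeriv_iff.1 (hR.hasWeakDirDeriv_vert hY hpos φ.2 iu ig)⟩
    rw [hasWeakDirDeriv_iff.1 (hR.hasWeakDirDeriv_hor hY hpos φ.2 iu v) η hη]
    congr 1
    refine integral_congr_ae ?_
    filter_upwards [Lp.coeFn_zero (Hor N) 2 (volume.restrict Y)] with q hq
    rw [hq]
    simp
  exact ⟨⟨⟨WithLp.toLp 2 (u, WithLp.toLp 2 (0, g)), hgrad⟩, rfl⟩, hR⟩

/-- The isometry between `H¹_⟨ξ⟩(Y)` and the graph space. -/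
theorem exists_isometry (hY : IsOpen Y) (hb : Bornology.IsBounded Y) (hpos : ∀ q ∈ Y, 0 < q.2) :
    ∃ T : H1Xi Y ≃ₗᵢ[ℝ] D.graphSpace, (∀ u, D.Represents (T u) (fn u) (dy u)) ∧
      ∀ φ : D.graphSpace, D.Represents φ (fn (T.symm φ)) (dy (T.symm φ)) := by
  -- `T` is obtained by choice; its linearity and surjectivity both come from uniqueness of the
  -- represented family.
  choose T hT using fun u : H1Xi Y => exists_represents (D := D) hY hb u
  let L : H1Xi Y →ₗᵢ[ℝ] D.graphSpace :=
    { toFun := T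
      map_add' := fun u v => (hT (u + v)).eq hY hb hpos ((hT u).add hY hb (hT v))
      map_smul' := fun c u => (hT (c • u)).eq hY hb hpos ((hT u).smul hY hb c)
      norm_map' := fun u => (hT u).norm_eq hY hb hpos }
  have hL : Function.Surjective L := fun φ =>
    (exists_represented hY hb hpos φ).imp fun u hu => (hT u).eq hY hb hpos hu
  let T' : H1Xi Y ≃ₗᵢ[ℝ] D.graphSpace := LinearIsometryEquiv.ofSurjective L hL
  have hT' : ∀ φ, T (T'.symm φ) = φ := fun φ => T'.apply_symm_apply φ
  exact ⟨T', hT, fun φ => Eq.subst (motive := fun ψ : D.graphSpace =>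
    D.Represents ψ (fn (T'.symm φ)) (dy (T'.symm φ))) (hT' φ) (hT (T'.symm φ))⟩

/-! ### The induced function -/

theorem exists_isInduced (hY : IsOpen Y) (F : D.Idx → ℝ → ℝ) : ∃ w, D.IsInduced F w := by
  classical
  let w : Pt N → ℝ := fun q =>
    if h : ∃ s, q ∈ D.piece s then F h.choose q.2
    else if h : ∃ s, q ∈ closure (D.piece s) ∧ q.2 = D.hi s then F h.choose (D.hi h.choose) else 0
  refine ⟨w, fun s q hq => ?_, fun s q hq hq2 => ?_⟩
  · have h : ∃ s, q ∈ D.piece s := ⟨s, hq⟩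
    simp only [w, dif_pos h]
    rw [D.eq_of_mem_piece h.choose_spec hq]
  · have h1 : ¬ ∃ s, q ∈ D.piece s := by
      rintro ⟨t, ht⟩
      have h := D.mem_Ioo_of_mem_piece ht
      rw [hq2] at h
      have l1 : t.1.castSucc < s.1.succ := D.a_strictMono.lt_iff_lt.1 h.1
      have l2 : s.1.succ < t.1.succ := D.a_strictMono.lt_iff_lt.1 h.2
      rw [Fin.lt_def] at l1 l2
      simp only [Fin.val_castSucc, Fin.val_succ] at l1 l2
      omega
    have h2 : ∃ s, q ∈ closure (D.piece s) ∧ q.2 = D.hi s := ⟨s, hq.2, hq2⟩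
    simp only [w, dif_neg h1, dif_pos h2]
    obtain ⟨s₀, t, hs₀, -, hJ⟩ := D.exists_junction hY hq.1 hq2
    -- Consistency on the interface: only one piece of the slab below has `q` in its closure.
    have key : ∀ s', q ∈ closure (D.piece s') → q.2 = D.hi s' → s' = s₀ := fun s' h h' => by
      refine hJ.eq_of_mem_closure D ?_ h
      rw [hs₀]
      exact Fin.succ_injective _ (D.a_strictMono.injective (h'.symm.trans hq2))
    rw [key _ h2.choose_spec.1 h2.choose_spec.2, key s hq.2 hq2]

/-- Every point of `Y` is in a piece or, through its junction, in the closure of a piece ending at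
its height, so some prescription reaches it. -/
theorem IsInduced.eqOn (hY : IsOpen Y) (hpos : ∀ q ∈ Y, 0 < q.2) {F : D.Idx → ℝ → ℝ}
    {w w' : Pt N → ℝ} (h : D.IsInduced F w) (h' : D.IsInduced F w') : EqOn w' w Y := by
  intro q hq
  obtain ⟨i, hi⟩ := D.exists_height hpos hq
  rcases hi.2.lt_or_eq with hlt | heq
  · obtain ⟨s, -, hs⟩ := D.exists_mem_piece i hq ⟨hi.1, hlt⟩
    rw [h.1 s q hs, h'.1 s q hs]
  · obtain ⟨s, t, -, -, hJ⟩ := D.exists_junction hY hq heq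
    have hc : q ∈ Y ∩ closure (D.piece s) := ⟨hq, hJ.mem_closure D⟩
    rw [h.2 s q hc hJ.1, h'.2 s q hc hJ.1]

theorem IsInduced.ae_eq (hY : IsOpen Y) (hb : Bornology.IsBounded Y) (hpos : ∀ q ∈ Y, 0 < q.2)
    {φ : PiLp 2 D.EdgeH1} {F : D.Idx → ℝ → ℝ} (hF : D.IsContRep φ F) {u g w : Pt N → ℝ}
    (hu : D.Represents φ u g) (h : D.IsInduced F w) : ∀ᵐ q ∂(volume.restrict Y), w q = u q := by
  refine D.ae_restrict_of_pieces hpos fun s => ?_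
  filter_upwards [hu s, D.ae_piece_of_ae hY hb (wMeasure_absolutelyContinuous.ae_le (hF s).2),
    ae_restrict_mem (D.piece_isOpen hY s).measurableSet] with q h1 h2 h3
  rw [h.1 s q h3, h1.1, h2]

theorem exists_isInduced_ae_eq (hY : IsOpen Y) (hb : Bornology.IsBounded Y)
    (hpos : ∀ q ∈ Y, 0 < q.2) {φ : PiLp 2 D.EdgeH1} {F : D.Idx → ℝ → ℝ} (hF : D.IsContRep φ F)
    {u g : Pt N → ℝ} (hu : D.Represents φ u g) :
    ∃ w : Pt N → ℝ, D.IsInduced F w ∧ (∀ w', D.IsInduced F w' → EqOn w' w Y) ∧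
      ∀ᵐ q ∂(volume.restrict Y), w q = u q := by
  obtain ⟨w, hw⟩ := exists_isInduced hY F
  exact ⟨w, hw, fun w' hw' => hw.eqOn hY hpos hw', hw.ae_eq hY hb hpos hF hu⟩

end NiceDecomposition

/-! ### What is needed of a model tooth, and the theorem. -/

theorem IsModelTooth.isBounded {N : ℕ} {Y : Set (Pt N)} (hY : IsModelTooth Y) :
    Bornology.IsBounded Y := by
  obtain ⟨R, L, -, -, h⟩ := hY.bounded
  refine (Metric.isBounded_ball.prod (Metric.isBounded_Ioo 0 L)).subset fun q hq =>
    (⟨mem_ball_zero_iff.2 (h q hq).1, (h q hq).2⟩ : q ∈ Metric.ball (0 : Hor N) R ×ˢ Ioo 0 L)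

theorem IsModelTooth.height_pos {N : ℕ} {Y : Set (Pt N)} (hY : IsModelTooth Y) :
    ∀ q ∈ Y, 0 < q.2 := by
  obtain ⟨R, L, -, -, h⟩ := hY.bounded
  exact fun q hq => (h q hq).2.1

end ThinGraph

end

open ThinGraph in
theorem mainTheorem7 {N : ℕ} (hN : 1 ≤ N) (Y : Set (Pt N)) (hY : IsModelTooth Y)
    (D : NiceDecomposition Y) :
    ∃ T : H1Xi Y ≃ₗᵢ[ℝ] D.graphSpace,
      (∀ (u : H1Xi Y) (s : D.Idx), ∀ᵐ q ∂(volume.restrict (D.piece s)),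
        fn u q = wfn (D.edge (T u) s) q.2 ∧ dy u q = wder (D.edge (T u) s) q.2) ∧
      (∀ u : H1Xi Y,
        ‖u‖ ^ 2 = ∑ s : D.Idx, ∫ q in D.piece s, (fn u q ^ 2 + dy u q ^ 2)) ∧
      (∀ φ : D.graphSpace,
        ‖φ‖ ^ 2 = ∑ s : D.Idx, ∫ y in Ioo (D.lo s) (D.hi s),
          D.p s y * (wfn (D.edge φ s) y ^ 2 + wder (D.edge φ s) y ^ 2)) ∧
      (∀ (φ : D.graphSpace) (F : D.Idx → ℝ → ℝ), D.IsContRep φ F →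
        ∃ w : Pt N → ℝ, D.IsInduced F w ∧ (∀ w', D.IsInduced F w' → EqOn w' w Y) ∧
          ∀ᵐ q ∂(volume.restrict Y), w q = fn (T.symm φ) q) := by
  have hb := hY.isBounded
  have hpos := hY.height_pos
  exact (NiceDecomposition.exists_isometry (D := D) hY.isOpen hb hpos).imp fun T hT =>
    ⟨fun u s => hT.1 u s, fun u => NiceDecomposition.norm_sq_H1Xi_eq_sum hY.isOpen hpos u,
      fun φ => (NiceDecomposition.norm_sq_graphSpace φ).trans
        (Finset.sum_congr rfl fun s _ => (D.isWeight s).integral_wMeasure _),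
      fun φ F hF => NiceDecomposition.exists_isInduced_ae_eq hY.isOpen hb hpos hF (hT.2 φ)⟩
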